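/- **Expressions.** Let $\Sigma$ be a finite non-empty alphabet. A *$T$-regular expression* over $\Sigma$ is given by $e ::= \emptyset \mid a \mid e\cdot e \mid e+e \mid e^* \mid e^T$ with $a\in\Sigma$. It denotes a language $\mathcal L(e)$ of infinite sequences $\vec u=(u_1,u_2,\ldots)$ of finite words over $\Sigma$: - $\mathcal L(\emptyset)=\emptyset$ and $\mathcal L(a)=\{(a,a,a,\ldots)\}$; - $\mathcal L(e_1\cdot e_2)=\{\vec w \mid w_i=u_iv_i \text{ for all } i,\ \text{for some } \vec u\in\mathcal L(e_1),\ \vec v\in\mathcal L(e_2)\}$; - $\mathcal L(e_1+e_2)=\{\vec w \mid w_i\in\{u_i,v_i\} \text{ for all } i,\ \text{for some } \vec u,\vec v\in\mathcal L(e_1)\cup\mathcal L(e_2)\}$; - $\mathcal L(e^*)$ is the set of all sequences $(u_{f(0)}\cdots u_{f(1)-1},\ u_{f(1)}\cdots u_{f(2)-1},\ \ldots)$, where $\vec u\in\mathcal L(e)$ and $f:\mathbb N\to\mathbb N_{>0}$ is nondecreasing and unbounded with $f(0)=1$ (a block with $f(i)=f(i+1)$ is the empty word); - $\mathcal L(e^T)$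 is defined like $\mathcal L(e^*)$, with the additional requirement that for infinitely many $n\in\mathbb N$ there are infinitely many $i$ with $f(i+1)-f(i)=n$. An *$\omega T$-regular expression* is given by $E ::= E+E\mid R\cdot E\mid e^\omega$, where $R$ is a regular expression and $e$ is a $T$-regular expression. It denotes a language $\mathcal L(E)\subseteq\Sigma^\omega$: - $\mathcal L(E_1+E_2)=\mathcal L(E_1)\cup\mathcal L(E_2)$; - $\mathcal L(R\cdot E)=\{xv\mid x\in\mathcal L(R),\ v\in\mathcal L(E)\}$; - $\mathcal L(e^\omega)$ is the set of $\omega$-words $w\in\Sigma^\omega$ with $w=u_1u_2u_3\cdots$ for some $\vec u\in\mathcal L(e)$. **Automata.** A *counter-check automaton* (CCA) over $\Sigma$ is a tuple $\mathcal A=(S,\Sigma,s_0,N,\Delta)$ with a finite set $S$ of states, an initial state $s_0\in S$, a number $N\geq 1$ of counters, and $\Delta\subseteq S\times(\Sigma\cup\{\epsilon\})\times S\times(\{1,\ldots,N\}\times\{\mathit{no\_op},\mathit{inc},\mathit{check}\})$, where $k=1$ whenever $(s,\sigma,s',(k,\mathit{no\_op}))\in\Delta$. A transition with operation $(k,op)$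 leaves the counters other than $k$ unchanged; it leaves counter $k$ unchanged, increases it by $1$, or resets it to $0$ if $op$ is $\mathit{no\_op}$, $\mathit{inc}$, or $\mathit{check}$, respectively. A *computation* is an infinite path of configurations $(s_i,v_i)\in S\times\mathbb N^N$, $i\in\mathbb N$, starting from $(s_0,0)$. It is a *run* of $w\in\Sigma^\omega$ if there are positions $f(1)<f(2)<\cdots$ such that for each $i\ge 1$ the step from position $f(i)$ to $f(i)+1$ can be made by a transition labelled with the $i$-th letter of $w$, and all other steps can be made by $\epsilon$-transitions. The run is *accepting* if for every counter $k$ there are infinitely many $n\in\mathbb N$ such that, for infinitely many $i$, counter $k$ has value $n$ in $v_i$ and value $0$ in $v_{i+1}$. $\mathcal L(\mathcal A)$ is the set of all $w\in\Sigma^\omega$ that have an accepting run. **Theorem.** For every $\omega T$-regular expression $E$ over $\Sigma$ there is a counter-check automaton $\mathcal A$ over $\Sigma$ such that $\mathcal L(E)=\mathcal L(\mathcal A)$. -/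

import Mathlib

/-! ### Words and word sequences

`ω`-words over `α` are functions `ℕ → α` and infinite sequences of finite words are functions
`ℕ → List α`; positions are counted from `0`. -/

namespace OmegaT

universe u

/-- `block u a b` is the finite word `u a ⬝ u (a + 1) ⬝ ⋯ ⬝ u (b - 1)`, empty if `b ≤ a`. -/
def block {α : Type u} (u : ℕ → List α) (a b : ℕ) : List α :=
  ((List.range' a (b - a)).map u).flatten

/-- `w = u 0 ⬝ u 1 ⬝ u 2 ⬝ ⋯` as `ω`-words: the concatenation is infinite, and each of its finite
pieces `u 0 ⬝ ⋯ ⬝ u (n - 1)` is a prefix of `w`. -/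
def IsConcat {α : Type u} (w : ℕ → α) (u : ℕ → List α) : Prop :=
  (∀ m : ℕ, ∃ n : ℕ, m < (block u 0 n).length) ∧
    ∀ (n i : ℕ) (h : i < (block u 0 n).length), w i = (block u 0 n)[i]

/-- The `ω`-word `x ⬝ w` for a finite word `x` and an `ω`-word `w`. -/
def appendWord {α : Type u} (x : List α) (w : ℕ → α) : ℕ → α :=
  fun i => if h : i < x.length then x[i] else w (i - x.length)

/-! ### `T`-regular and `ωT`-regular expressions -/

/-- `T`-regular expressions: `e ::= ∅ | a | e ⬝ e | e + e | e^* | e^T`. -/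
inductive TRegExp (α : Type u) : Type u
  | empty : TRegExp α
  | letter : α → TRegExp α
  | concat : TRegExp α → TRegExp α → TRegExp α
  | plus : TRegExp α → TRegExp α → TRegExp α
  | star : TRegExp α → TRegExp α
  | texp : TRegExp α → TRegExp α

/-- A function cutting a word sequence into consecutive finite blocks: it starts at the first
position and is nondecreasing and unbounded. -/
structure IsCut (f : ℕ → ℕ) : Prop where
  zero : f 0 = 0
  mono : Monotone f
  unbounded : ∀ m : ℕ, ∃ i : ℕ, m < f i

/-- The language of word sequences of a `T`-regular expression. -/
def TRegExp.lang {α : Type u} : TRegExp α → Set (ℕ → List α)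
  | .empty => ∅
  | .letter a => {fun _ => [a]}
  | .concat e₁ e₂ =>
      {w | ∃ u ∈ e₁.lang, ∃ v ∈ e₂.lang, ∀ i, w i = u i ++ v i}
  | .plus e₁ e₂ =>
      {w | ∃ u ∈ e₁.lang ∪ e₂.lang, ∃ v ∈ e₁.lang ∪ e₂.lang, ∀ i, w i = u i ∨ w i = v i}
  | .star e =>
      {w | ∃ u ∈ e.lang, ∃ f : ℕ → ℕ, IsCut f ∧ ∀ i, w i = block u (f i) (f (i + 1))}
  | .texp e =>
      {w | ∃ u ∈ e.lang, ∃ f : ℕ → ℕ, IsCut f ∧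
        {n : ℕ | ∀ k : ℕ, ∃ i > k, f (i + 1) - f i = n}.Infinite ∧
        ∀ i, w i = block u (f i) (f (i + 1))}

/-- `ωT`-regular expressions: `E ::= E + E | R ⬝ E | e^ω` with `R` a regular expression and `e` a
`T`-regular expression. -/
inductive OmegaTRegExp (α : Type u) : Type u
  | plus : OmegaTRegExp α → OmegaTRegExp α → OmegaTRegExp α
  | concat : RegularExpression α → OmegaTRegExp α → OmegaTRegExp α
  | omega : TRegExp α → OmegaTRegExp α

/-- The language of `ω`-words of an `ωT`-regular expression. -/
def OmegaTRegExp.lang {α : Type u} : OmegaTRegExp α → Set (ℕ → α)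
  | .plus E₁ E₂ => E₁.lang ∪ E₂.lang
  | .concat R E => {w | ∃ x ∈ R.matches', ∃ v ∈ E.lang, w = appendWord x v}
  | .omega e => {w | ∃ u ∈ e.lang, IsConcat w u}

/-! ### Counter-check automata -/

/-- The operations on a counter. -/
inductive CounterOp : Type
  | noOp
  | inc
  | check

/-- Counter-check automata over the alphabet `α`. The label `none` stands for `ε`, and the counters
are numbered from `0`. -/
structure CCA (α : Type u) where
  /-- the states -/
  State : Type
  finite_state : Finite State
  /-- the initial state -/
  start : State
  /-- the number of counters -/
  N : ℕ
  N_pos : 0 < N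
  /-- the transition relation -/
  Δ : Set (State × Option α × State × (Fin N × CounterOp))
  noOp_first : ∀ (s : State) (σ : Option α) (s' : State) (k : Fin N),
    (s, σ, s', (k, CounterOp.noOp)) ∈ Δ → k = ⟨0, N_pos⟩

namespace CCA

variable {α : Type u} (A : CCA α)

/-- A configuration: a state and a counter vector. -/
abbrev Config : Type := A.State × (Fin A.N → ℕ)

/-- The new value of the affected counter. -/
def newValue : CounterOp → ℕ → ℕ
  | .noOp, n => n
  | .inc, n => n + 1
  | .check, _ => 0

/-- The step relation between configurations, labelled by a letter or `ε`. -/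
def Step (σ : Option α) (c c' : A.Config) : Prop :=
  ∃ (k : Fin A.N) (op : CounterOp), (c.1, σ, c'.1, (k, op)) ∈ A.Δ ∧
    (∀ h, h ≠ k → c'.2 h = c.2 h) ∧ c'.2 k = newValue op (c.2 k)

/-- Computations: infinite paths of configurations from the initial configuration. -/
def IsComputation (π : ℕ → A.Config) : Prop :=
  π 0 = (A.start, fun _ => 0) ∧ ∀ i, ∃ σ : Option α, A.Step σ (π i) (π (i + 1))

/-- Along `π`, the `j`-th configuration is reached from the `i`-th one by `ε`-steps. -/
def EpsReach (π : ℕ → A.Config) (i j : ℕ) : Prop :=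
  i ≤ j ∧ ∀ m, i ≤ m → m < j → A.Step none (π m) (π (m + 1))

/-- `π` is a run of the `ω`-word `w`: for some increasing trace `f`, the letter `w i` is read in
the step from position `f i` to `f i + 1`, and all other steps are `ε`-steps. -/
def IsRun (w : ℕ → α) (π : ℕ → A.Config) : Prop :=
  A.IsComputation π ∧ ∃ f : ℕ → ℕ, StrictMono f ∧ A.EpsReach π 0 (f 0) ∧
    ∀ i, A.Step (some (w i)) (π (f i)) (π (f i + 1)) ∧ A.EpsReach π (f i + 1) (f (i + 1))

/-- The values of the counter `k` that are checked infinitely often along `π`. -/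
def infCheck (π : ℕ → A.Config) (k : Fin A.N) : Set ℕ :=
  {n | ∀ h : ℕ, ∃ i > h, (π i).2 k = n ∧ (π (i + 1)).2 k = 0}

/-- The language of `ω`-words accepted by `A`. -/
def lang : Set (ℕ → α) :=
  {w | ∃ π : ℕ → A.Config, A.IsRun w π ∧ ∀ k, (A.infCheck π k).Infinite}

end CCA

end OmegaT

namespace OmegaT

universe u v

/-! ### Closure properties of regular languages -/

section Regular

variable {α : Type u} {β : Type v}

/-! Counter operations and output letters are treated as letters of one alphabet of events, so that
everything apart from the acceptance condition becomes a statement about regular languages. A word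
sequence is represented by event words `y 0, y 1, …` from a regular language `X`: the outputs of `y
i` spell its `i`-th word. The counters are not reset between these words, so each one acts on a
single infinite stream of operations, along which it must check infinitely many values infinitely
often (`seqLang`).

Every `T`-regular expression denotes a finite union of such languages (`TRegExp.isSeqRecognizable`).
The union has to stay outside: its index is fixed for the whole sequence, whereas a union of the
languages `X j` would allow a different choice for each word. Concatenation juxtaposes event words
with disjoint counters. For `+`, the event words of both operands are run at every position and the
output of one is suppressed. The star is the Kleene star of `X`. The operator `T` adds a counter
that counts the words in each block. These steps rest on two facts: the condition on a counter
depends only on its stream of operations and not on how it is cut (`IsCut.infChecks_iff`), and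
surplus counters can always be satisfied without output (`seqLang_silent`).

For `ω`-words, a separate regular language for the first event word absorbs the finite prefixes
(`IsOmegaRecognizable.prefix`). Finally, deterministic automata for the event languages are chained.
An additional counter, checked after each event word, plays the role of a Büchi condition and forces
infinitely many words to be completed. The resulting automaton on events is a counter-check
automaton up to renaming (`eventLang_eq_lang`). -/

theorem isRegular_of_leftQuotient_mem {L : Language α} {S : Set (Language α)} (hS : S.Finite)
    (h : ∀ x, L.leftQuotient x ∈ S) : L.IsRegular :=
  .of_finite_range_leftQuotient (hS.subset (by rintro _ ⟨x, rfl⟩; exact h x))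

theorem isRegular_singleton_letter (a : α) : ({[a]} : Language α).IsRegular := by
  refine isRegular_of_leftQuotient_mem
    (S := {({[a]} : Language α), 1, 0}) (Set.toFinite _) ?_
  intro x
  have key : ∀ z, z ∈ ({[a]} : Language α).leftQuotient x ↔ x ++ z = [a] := fun z => Iff.rfl
  rcases x with _ | ⟨b, x⟩
  · left; rfl
  · right
    by_cases hb : b = a ∧ x = []
    · left
      obtain ⟨rfl, rfl⟩ := hb
      ext z
      exact (key z).trans (by simp [Language.mem_one])
    · right
      ext z
      refine (key z).trans ?_
      simp only [List.cons_append, List.cons.injEq, List.append_eq_nil_iff]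
      constructor
      · rintro ⟨h1, h2, -⟩
        exact hb ⟨h1, h2⟩
      · exact False.elim

/-- The words all of whose letters satisfy `p`. -/
def wordsOver (p : α → Prop) : Language α := {x : List α | ∀ e ∈ x, p e}

theorem isRegular_wordsOver (p : α → Prop) : (wordsOver p).IsRegular := by
  refine isRegular_of_leftQuotient_mem
    (S := {wordsOver p, 0}) (Set.toFinite _) ?_
  intro x
  have key : ∀ z, z ∈ (wordsOver p).leftQuotient x ↔ ∀ e ∈ x ++ z, p e :=
    fun z => Iff.rfl
  by_cases hx : ∀ e ∈ x, p e
  · left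
    ext z
    refine (key z).trans ?_
    simp only [List.mem_append]
    exact ⟨fun h e he => h e (Or.inr he), fun h e he => he.elim (hx e) (h e)⟩
  · right
    ext z
    refine (key z).trans ⟨fun h => hx fun e he => h e (List.mem_append_left _ he), False.elim⟩

theorem isRegular_one : (1 : Language α).IsRegular := by
  have h := isRegular_wordsOver (fun _ : α => False)
  convert h using 1
  ext x
  rcases x with _ | ⟨b, x⟩
  · exact ⟨fun _ e he => by simp at he, fun _ => rfl⟩
  · exact ⟨fun h => by simp [Language.mem_one] at h, fun h => (h b (by simp)).elim⟩

theorem isRegular_zero : (0 : Language α).IsRegular := by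
  refine isRegular_of_leftQuotient_mem (S := {(0 : Language α)}) (Set.toFinite _) ?_
  intro x
  ext z
  exact Iff.rfl

/-- The left quotient of `L * M` by `x` is `L.leftQuotient x * M` together with all `M.leftQuotient
y` for splittings `x = a ++ y` with `a ∈ L`. It is thus determined by one quotient of `L` and a set
of quotients of `M`, which leaves finitely many possibilities. -/
theorem isRegular_mul {L M : Language α} (hL : L.IsRegular) (hM : M.IsRegular) :
    (L * M).IsRegular := by
  have fL := hL.finite_range_leftQuotient
  have fM := hM.finite_range_leftQuotient
  let F : Language α → Set (Language α) → Language α :=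
    fun A B => {z | z ∈ A * M ∨ ∃ C ∈ B, z ∈ C}
  refine isRegular_of_leftQuotient_mem (Set.Finite.image2 F fL fM.powerset) ?_
  intro x
  refine ⟨L.leftQuotient x, ⟨x, rfl⟩, {C | ∃ a ∈ L, ∃ y, a ++ y = x ∧ C = M.leftQuotient y}, ?_, ?_⟩
  · rintro C ⟨a, -, y, -, rfl⟩
    exact ⟨y, rfl⟩
  · ext z
    constructor
    · rintro (h | ⟨C, ⟨a, ha, y, rfl, rfl⟩, h⟩)
      · obtain ⟨a, ha, b, hb, rfl⟩ := Language.mem_mul.1 h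
        exact Language.mem_mul.2 ⟨x ++ a, ha, b, hb, by simp⟩
      · exact Language.mem_mul.2 ⟨a, ha, y ++ z, h, by simp⟩
    · intro h
      obtain ⟨a, ha, b, hb, hab⟩ := Language.mem_mul.1 ((Language.mem_leftQuotient x z).1 h)
      rcases List.append_eq_append_iff.1 hab with ⟨c, rfl, rfl⟩ | ⟨c, rfl, rfl⟩
      · exact Or.inr ⟨_, ⟨a, ha, c, rfl, rfl⟩, hb⟩
      · exact Or.inl (Language.mem_mul.2 ⟨c, ha, b, hb, rfl⟩)

/-- For `x ≠ []`, the factor in which `x` ends is split as `y ++ c`, so the quotient by `x` is the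
union of `L.leftQuotient y * L∗` over splittings `x = a ++ y` with `a ∈ L∗`. The empty `x` is
separate because `L * L∗` may lack the empty word. -/
theorem isRegular_kstar {L : Language α} (hL : L.IsRegular) : (KStar.kstar L).IsRegular := by
  have fL := hL.finite_range_leftQuotient
  let F : Set (Language α) → Language α := fun B => {z | ∃ C ∈ B, z ∈ C * KStar.kstar L}
  refine isRegular_of_leftQuotient_mem ((fL.powerset.image F).insert (KStar.kstar L)) ?_
  intro x
  rcases eq_or_ne x [] with rfl | hx
  · exact Or.inl rfl
  refine Or.inr ⟨{C | ∃ a ∈ KStar.kstar L, ∃ y, a ++ y = x ∧ C = L.leftQuotient y}, ?_, ?_⟩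
  · rintro C ⟨a, -, y, -, rfl⟩
    exact ⟨y, rfl⟩
  · ext z
    constructor
    · rintro ⟨C, ⟨a, ha, y, rfl, rfl⟩, h⟩
      obtain ⟨c, hc, b, hb, rfl⟩ := Language.mem_mul.1 h
      obtain ⟨la, rfl, hla⟩ := ha
      obtain ⟨lb, rfl, hlb⟩ := hb
      refine ⟨la ++ (y ++ c) :: lb, by simp, ?_⟩
      intro t ht
      rcases List.mem_append.1 ht with ht | ht
      · exact hla t ht
      · rcases List.mem_cons.1 ht with rfl | ht
        · exact hc
        · exact hlb t ht
    · rintro ⟨l, hl, hmem⟩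
      suffices H : ∀ (l : List (List α)) (x : List α), x ≠ [] → x ++ z = l.flatten →
          (∀ t ∈ l, t ∈ L) → ∃ a ∈ KStar.kstar L, ∃ y, a ++ y = x ∧
            z ∈ L.leftQuotient y * KStar.kstar L by
        obtain ⟨a, ha, y, hy, hz⟩ := H l x hx hl hmem
        exact ⟨_, ⟨a, ha, y, hy, rfl⟩, hz⟩
      clear hl hmem hx l x
      intro l
      induction l with
      | nil => intro x hx h; simp at h; exact absurd h.1 hx
      | cons t l ih =>
        intro x hx h hmem
        have ht : t ∈ L := hmem t (by simp)
        have hl : ∀ s ∈ l, s ∈ L := fun s hs => hmem s (by simp [hs])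
        rw [List.flatten_cons] at h
        rcases List.append_eq_append_iff.1 h with ⟨c, rfl, rfl⟩ | ⟨c, rfl, h2⟩
        · exact ⟨[], Language.nil_mem_kstar L, x, rfl, Language.mem_mul.2
            ⟨c, ht, _, Language.join_mem_kstar hl, rfl⟩⟩
        -- If `x` ends exactly at a factor boundary, nothing nonempty remains for the recursion; the
        -- whole last factor is then taken as `y`.
        · rcases eq_or_ne c [] with rfl | hc
          · simp only [List.nil_append] at h2
            refine ⟨[], Language.nil_mem_kstar L, t, by simp, Language.mem_mul.2
              ⟨[], ?_, z, ?_, rfl⟩⟩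
            · simpa using ht
            · rw [← h2]; exact Language.join_mem_kstar hl
          · obtain ⟨a, ⟨la, rfl, hla⟩, y, rfl, hz⟩ := ih c hc h2.symm hl
            refine ⟨t ++ la.flatten, ⟨t :: la, by simp, ?_⟩, y, by simp, hz⟩
            intro s hs
            rcases List.mem_cons.1 hs with rfl | hs
            · exact ht
            · exact hla s hs

theorem isRegular_map (f : α → β) {L : Language α} (hL : L.IsRegular) :
    (Language.map f L).IsRegular := by
  have fL := hL.finite_range_leftQuotient
  let F : Set (Language α) → Language β := fun B => {z | ∃ C ∈ B, z ∈ Language.map f C}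
  refine isRegular_of_leftQuotient_mem (fL.powerset.image F) ?_
  intro x
  refine ⟨{C | ∃ y, y.map f = x ∧ C = L.leftQuotient y}, ?_, ?_⟩
  · rintro C ⟨y, -, rfl⟩
    exact ⟨y, rfl⟩
  · ext z
    constructor
    · rintro ⟨C, ⟨y, rfl, rfl⟩, t, ht, rfl⟩
      exact ⟨y ++ t, ht, by simp⟩
    · rintro ⟨t, ht, h⟩
      obtain ⟨y, s, rfl, rfl, rfl⟩ := List.map_eq_append_iff.1 h
      exact ⟨_, ⟨y, rfl, rfl⟩, s, ht, rfl⟩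

theorem isRegular_matches' (R : RegularExpression α) : R.matches'.IsRegular := by
  induction R with
  | zero => exact isRegular_zero
  | epsilon => exact isRegular_one
  | char a => exact isRegular_singleton_letter a
  | plus P Q hP hQ => exact hP.add hQ
  | comp P Q hP hQ => exact isRegular_mul hP hQ
  | star P hP => exact isRegular_kstar hP

end Regular

/-! ### Blocks of word sequences -/

section Block

variable {α : Type u} {β : Type v}

theorem block_self (u : ℕ → List α) (a : ℕ) : block u a a = [] := by
  simp [block]

theorem block_succ {u : ℕ → List α} {a b : ℕ} (h : a ≤ b) :
    block u a (b + 1) = block u a b ++ u b := by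
  have h1 : b + 1 - a = (b - a) + 1 := by omega
  have h2 : a + (b - a) = b := by omega
  simp [block, h1, List.range'_concat, h2]

theorem block_append (u : ℕ → List α) {a b c : ℕ} (hab : a ≤ b) (hbc : b ≤ c) :
    block u a b ++ block u b c = block u a c := by
  induction c, hbc using Nat.le_induction with
  | base => simp [block_self]
  | succ c hbc ih => rw [block_succ hbc, block_succ (hab.trans hbc), ← List.append_assoc, ih]

theorem block_congr {u v : ℕ → List α} {a b : ℕ} (h : ∀ i, a ≤ i → i < b → u i = v i) :
    block u a b = block v a b := by
  unfold block
  congr 1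
  refine List.map_congr_left fun i hi => ?_
  rw [List.mem_range'_1] at hi
  exact h i hi.1 (by omega)

theorem apply_block {φ : List α → List β} (h0 : φ [] = []) (h : ∀ x y, φ (x ++ y) = φ x ++ φ y)
    (u : ℕ → List α) (a b : ℕ) : φ (block u a b) = block (fun i => φ (u i)) a b := by
  unfold block
  induction List.range' a (b - a) with
  | nil => simpa using h0
  | cons i l ih => simp [h, ih]

theorem block_map_block {u : ℕ → List α} {f : ℕ → ℕ} (hf : Monotone f) {a b : ℕ} (hab : a ≤ b) :
    block (fun i => block u (f i) (f (i + 1))) a b = block u (f a) (f b) := by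
  induction b, hab using Nat.le_induction with
  | base => simp [block_self]
  | succ b hab ih => rw [block_succ hab, ih, block_append u (hf hab) (hf b.le_succ)]

theorem block_singleton (w : ℕ → α) (a b : ℕ) :
    block (fun n => [w n]) a b = (List.range' a (b - a)).map w := by
  unfold block
  induction List.range' a (b - a) with
  | nil => rfl
  | cons i l ih => simpa using ih

theorem block_eq_of_forall_nil {u : ℕ → List α} {a b : ℕ} (hab : a ≤ b)
    (h : ∀ i, a ≤ i → u i = []) (c : ℕ) (hca : c ≤ a) : block u c b = block u c a := by
  induction b, hab using Nat.le_induction with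
  | base => rfl
  | succ b hab ih => rw [block_succ (hca.trans hab), ih, h b hab, List.append_nil]

theorem prefix_block (u : ℕ → List α) {m n : ℕ} (h : m ≤ n) : block u 0 m <+: block u 0 n :=
  ⟨_, block_append u (Nat.zero_le m) h⟩

theorem exists_lt_length_block {u : ℕ → List α} (hu : ∀ m, ∃ i ≥ m, u i ≠ []) (m : ℕ) :
    ∃ n, m < (block u 0 n).length := by
  induction m with
  | zero =>
    obtain ⟨i, -, hi⟩ := hu 0
    refine ⟨i + 1, ?_⟩
    rw [block_succ (Nat.zero_le i), List.length_append]
    have := List.length_pos_iff.2 hi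
    omega
  | succ m ih =>
    obtain ⟨n, hn⟩ := ih
    obtain ⟨i, hi, hne⟩ := hu n
    refine ⟨i + 1, ?_⟩
    rw [block_succ (Nat.zero_le i), List.length_append]
    have := List.length_pos_iff.2 hne
    have := (prefix_block u hi).length_le
    omega

theorem exists_isConcat {u : ℕ → List α} (hu : ∀ m, ∃ i ≥ m, u i ≠ []) :
    ∃ w : ℕ → α, IsConcat w u := by
  have h := exists_lt_length_block hu
  choose N hN using h
  refine ⟨fun m => (block u 0 (N m))[m]'(hN m), fun m => ⟨N m, hN m⟩, fun n i hi => ?_⟩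
  rcases le_total n (N i) with hle | hle
  · exact ((prefix_block u hle).getElem hi).symm
  · exact (prefix_block u hle).getElem (hN i)

theorem IsConcat.block_eq {w : ℕ → α} {u : ℕ → List α} (h : IsConcat w u) (n : ℕ) :
    block u 0 n = block (fun i => [w i]) 0 (block u 0 n).length := by
  rw [block_singleton]
  refine List.ext_getElem (by simp) fun i h1 h2 => ?_
  simp [h.2 n i h1]

theorem isCut_length {u : ℕ → List α} (hu : ∀ m, ∃ n, m < (block u 0 n).length) :
    IsCut fun n => (block u 0 n).length where
  zero := by simp [block_self]
  mono _ _ h := (prefix_block u h).length_le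
  unbounded := hu

/-- The cut points are the lengths of the finite concatenations `u 0 ⬝ ⋯ ⬝ u (n - 1)`. Thus any
sequence with an infinite concatenation is a regrouping of the sequence of one-letter words. -/
theorem IsConcat.exists_cut {w : ℕ → α} {u : ℕ → List α} (h : IsConcat w u) :
    ∃ f, IsCut f ∧ ∀ i, u i = block (fun n => [w n]) (f i) (f (i + 1)) := by
  refine ⟨_, isCut_length h.1, fun i => ?_⟩
  have hm := (isCut_length h.1).mono i.le_succ
  have h1 := h.block_eq (i + 1)
  rw [← block_append _ (Nat.zero_le _) hm, block_succ (Nat.zero_le i)] at h1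
  conv_lhs at h1 => rw [h.block_eq i]
  rw [← block_succ (Nat.zero_le i)] at h1
  exact List.append_cancel_left h1

theorem isConcat_singleton (w : ℕ → α) : IsConcat w fun i => [w i] := by
  refine ⟨fun m => ⟨m + 1, by simp [block_singleton]⟩, fun n i h => ?_⟩
  simp only [block_singleton, List.getElem_map, List.getElem_range']
  simp

theorem IsCut.isConcat_iff {f : ℕ → ℕ} (hf : IsCut f) {w : ℕ → α} {u : ℕ → List α} :
    IsConcat w (fun i => block u (f i) (f (i + 1))) ↔ IsConcat w u := by
  have key : ∀ n, block (fun i => block u (f i) (f (i + 1))) 0 n = block u 0 (f n) := fun n => by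
    rw [block_map_block hf.mono (Nat.zero_le n), hf.zero]
  unfold IsConcat
  simp only [key]
  constructor
  · rintro ⟨h1, h2⟩
    refine ⟨fun m => ?_, fun n i hi => ?_⟩
    · obtain ⟨n, hn⟩ := h1 m
      exact ⟨f n, hn⟩
    · obtain ⟨m, hm⟩ := hf.unbounded n
      have hp := prefix_block u hm.le
      rw [h2 m i (hi.trans_le hp.length_le)]
      exact (hp.getElem hi).symm
  · rintro ⟨h1, h2⟩
    refine ⟨fun m => ?_, fun n i hi => h2 _ i hi⟩
    obtain ⟨n, hn⟩ := h1 m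
    obtain ⟨k, hk⟩ := hf.unbounded n
    exact ⟨k, hn.trans_le (prefix_block u hk.le).length_le⟩

/-- All nonempty initial blocks of `v` and `u` differ exactly by the prefix `r`; comparisons are
made at `n + 1` because the block of length zero does not contain `r`. -/
theorem isConcat_cons_append_iff {w : ℕ → α} {r : List α} {u v : ℕ → List α}
    (h0 : v 0 = r ++ u 0) (hs : ∀ i, v (i + 1) = u (i + 1)) :
    IsConcat w v ↔ ∃ w', w = appendWord r w' ∧ IsConcat w' u := by
  have key : ∀ n, block v 0 (n + 1) = r ++ block u 0 (n + 1) := fun n => by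
    rw [← block_append v (Nat.zero_le 1) (by omega), ← block_append u (Nat.zero_le 1) (by omega),
      ← List.append_assoc]
    congr 1
    · simp [block, h0]
    · refine block_congr fun i hi _ => ?_
      obtain ⟨j, rfl⟩ : ∃ j, i = j + 1 := ⟨i - 1, by omega⟩
      exact hs j
  constructor
  · rintro ⟨h1, h2⟩
    refine ⟨fun i => w (r.length + i), ?_, fun m => ?_, fun n i hi => ?_⟩
    · funext i
      unfold appendWord
      split_ifs with hi
      · obtain ⟨n, hn⟩ := h1 i
        have hn' := hn.trans_le (prefix_block v (Nat.le_add_right n 1)).length_le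
        rw [h2 (n + 1) i hn']
        simp only [key, List.getElem_append_left hi]
      · congr 1; omega
    · obtain ⟨n, hn⟩ := h1 (r.length + m)
      have hn' := hn.trans_le (prefix_block v (Nat.le_add_right n 1)).length_le
      rw [key, List.length_append] at hn'
      exact ⟨n + 1, by omega⟩
    · have hi' := hi.trans_le (prefix_block u (Nat.le_add_right n 1)).length_le
      change w (r.length + i) = _
      rw [h2 (n + 1) (r.length + i) (by rw [key, List.length_append]; omega)]
      simp only [key]
      rw [List.getElem_append_right (by omega)]
      simp only [Nat.add_sub_cancel_left]
      exact ((prefix_block u (Nat.le_add_right n 1)).getElem hi).symm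
  · rintro ⟨w', rfl, h1, h2⟩
    refine ⟨fun m => ?_, fun n i hi => ?_⟩
    · obtain ⟨n, hn⟩ := h1 m
      have hn' := hn.trans_le (prefix_block u (Nat.le_add_right n 1)).length_le
      exact ⟨n + 1, by rw [key, List.length_append]; omega⟩
    · have hi' := hi.trans_le (prefix_block v (Nat.le_add_right n 1)).length_le
      have e : (block v 0 n)[i] = (block v 0 (n + 1))[i] := (prefix_block v (Nat.le_add_right n 1)).getElem hi
      rw [e]
      simp only [key]
      unfold appendWord
      split_ifs with h
      · rw [List.getElem_append_left h]
      · rw [List.getElem_append_right (by omega)]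
        exact h2 _ _ _

end Block

/-! ### Checked values of a counter -/

/-- The values checked by a sequence of operations on a counter with initial value `n`; `true`
stands for an increment and `false` for a check. -/
def checked : ℕ → List Bool → List ℕ
  | _, [] => []
  | n, true :: l => checked (n + 1) l
  | n, false :: l => n :: checked 0 l

/-- The final value of a counter with initial value `n`. -/
def finalValue : ℕ → List Bool → ℕ
  | n, [] => n
  | n, true :: l => finalValue (n + 1) l
  | _, false :: l => finalValue 0 l

theorem checked_append (n : ℕ) (l l' : List Bool) :
    checked n (l ++ l') = checked n l ++ checked (finalValue n l) l' := by
  induction l generalizing n with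
  | nil => rfl
  | cons b l ih => cases b <;> simp [checked, finalValue, ih]

theorem finalValue_append (n : ℕ) (l l' : List Bool) :
    finalValue n (l ++ l') = finalValue (finalValue n l) l' := by
  induction l generalizing n with
  | nil => rfl
  | cons b l ih => cases b <;> simp [finalValue, ih]

theorem checked_replicate (n k : ℕ) : checked n (List.replicate k true ++ [false]) = [n + k] := by
  induction k generalizing n with
  | zero => rfl
  | succ k ih => simp only [List.replicate_succ, List.cons_append, checked, ih]; congr 1; omega

theorem finalValue_replicate (n k : ℕ) :
    finalValue n (List.replicate k true ++ [false]) = 0 := by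
  rw [finalValue_append]; rfl

/-- The sequence of counter operations checks infinitely many values infinitely often. -/
def InfChecks (b : ℕ → List Bool) : Prop :=
  {n | ∀ c, ∃ m, c ≤ (checked 0 (block b 0 m)).count n}.Infinite

theorem count_checked_mono (b : ℕ → List Bool) {m m' : ℕ} (h : m ≤ m') (n : ℕ) :
    (checked 0 (block b 0 m)).count n ≤ (checked 0 (block b 0 m')).count n := by
  rw [← block_append b (Nat.zero_le m) h, checked_append, List.count_append]
  exact Nat.le_add_right _ _

theorem InfChecks.exists_ne_nil {b : ℕ → List Bool} (hb : InfChecks b) (m : ℕ) :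
    ∃ i ≥ m, b i ≠ [] := by
  by_contra! h
  obtain ⟨n, hn⟩ := hb.nonempty
  obtain ⟨m', hm'⟩ := hn ((checked 0 (block b 0 m)).count n + 1)
  rcases le_total m m' with hle | hle
  · rw [block_eq_of_forall_nil hle h 0 (Nat.zero_le _)] at hm'
    omega
  · have := count_checked_mono b hle n
    omega

/-- Regrouping leaves the stream of operations intact, and counts of checked values grow along
prefixes, so a cofinal family of prefixes decides the condition. -/
theorem IsCut.infChecks_iff {f : ℕ → ℕ} (hf : IsCut f) {b : ℕ → List Bool} :
    InfChecks (fun i => block b (f i) (f (i + 1))) ↔ InfChecks b := by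
  unfold InfChecks
  have key : ∀ n, block (fun i => block b (f i) (f (i + 1))) 0 n = block b 0 (f n) := fun n => by
    rw [block_map_block hf.mono (Nat.zero_le n), hf.zero]
  simp only [key]
  congr! 3 with n
  refine forall_congr' fun c => ?_
  constructor
  · rintro ⟨m, hm⟩
    exact ⟨f m, hm⟩
  · rintro ⟨m, hm⟩
    obtain ⟨k, hk⟩ := hf.unbounded m
    exact ⟨k, hm.trans (count_checked_mono b hk.le n)⟩

theorem forall_exists_le_count_iff (p : ℕ → Prop) [DecidablePred p] :
    (∀ c, ∃ m, c ≤ Nat.count p m) ↔ ∀ k, ∃ i > k, p i := by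
  constructor
  · intro h k
    obtain ⟨m, hm⟩ := h (Nat.count p (k + 1) + 1)
    by_contra! hp
    have hle : ∀ d, Nat.count p (k + 1 + d) ≤ Nat.count p (k + 1) := by
      intro d
      induction d with
      | zero => rfl
      | succ d ih =>
        rw [← add_assoc, Nat.count_succ, if_neg (hp _ (by omega))]
        exact ih
    have h1 := hle m
    have h2 : Nat.count p m ≤ Nat.count p (k + 1 + m) := Nat.count_monotone p (by omega)
    omega
  · intro h c
    induction c with
    | zero => exact ⟨0, Nat.zero_le _⟩
    | succ c ih =>
      obtain ⟨m, hm⟩ := ih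
      obtain ⟨i, hi, hpi⟩ := h m
      refine ⟨i + 1, ?_⟩
      rw [Nat.count_succ, if_pos hpi]
      have := Nat.count_monotone p hi.le
      omega

/-- Each check returns the counter to `0`, so the `i`-th checked value is exactly `g i`. -/
theorem infChecks_replicate_iff (g : ℕ → ℕ) :
    InfChecks (fun i => List.replicate (g i) true ++ [false]) ↔
      {n | ∀ k, ∃ i > k, g i = n}.Infinite := by
  have key : ∀ m, checked 0 (block (fun i => List.replicate (g i) true ++ [false]) 0 m) =
      (List.range m).map g ∧
      finalValue 0 (block (fun i => List.replicate (g i) true ++ [false]) 0 m) = 0 := by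
    intro m
    induction m with
    | zero => simp [block_self, checked, finalValue]
    | succ m ih =>
      rw [block_succ (Nat.zero_le m), checked_append, finalValue_append, finalValue_replicate,
        ih.1, ih.2, checked_replicate, List.range_succ]
      simp
  have hc : ∀ m n, ((List.range m).map g).count n = Nat.count (fun i => g i = n) m := by
    intro m n
    induction m with
    | zero => simp
    | succ m ih =>
      rw [List.range_succ, List.map_append, List.count_append, ih, Nat.count_succ]
      simp [List.count_singleton]
  unfold InfChecks
  simp only [fun m => (key m).1, hc, forall_exists_le_count_iff]

/-- Supplies the values for counters that may be operated freely: the first coordinate of the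
unpairing takes every value infinitely often. -/
theorem infinite_setOf_unpair_fst (c : ℕ) :
    {n | ∀ k, ∃ i > k, (Nat.unpair i).1 + c = n}.Infinite := by
  refine Set.infinite_of_injective_forall_mem (f := fun n : ℕ => n + c)
    (add_left_injective c) fun n k => ?_
  refine ⟨Nat.pair n (k + 1), lt_of_lt_of_le k.lt_succ_self (Nat.right_le_pair _ _), by simp⟩

/-! ### Event words -/

/-- The letters of the words read by an automaton with counters in `K`: an output, which is a
letter or silent, or an operation on a counter, where `true` is an increment and `false` a check. -/
inductive Event (α : Type u) (K : Type) : Type u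
  | out : Option α → Event α K
  | op : K → Bool → Event α K

namespace Event

variable {α : Type u} {K K' K₁ K₂ : Type}

/-- Change the outputs and the counters of an event. -/
def map (g : Option α → Option α) (φ : K → K') : Event α K → Event α K'
  | out o => out (g o)
  | op k b => op (φ k) b

/-- The letter put out by an event. -/
def label : Event α K → Option α
  | out o => o
  | op _ _ => none

open Classical in
/-- The operation of an event on the counter `k`. -/
noncomputable def opOn (k : K) : Event α K → Option Bool
  | out _ => none
  | op k' b => if k' = k then some b else none

/-- The finite word put out by a word of events. -/
def output (x : List (Event α K)) : List α := x.filterMap label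

/-- The operations of a word of events on the counter `k`. -/
noncomputable def ops (k : K) (x : List (Event α K)) : List Bool := x.filterMap (opOn k)

@[simp] theorem output_nil : output ([] : List (Event α K)) = [] := rfl

@[simp] theorem ops_nil (k : K) : ops k ([] : List (Event α K)) = [] := rfl

@[simp] theorem output_append (x y : List (Event α K)) :
    output (x ++ y) = output x ++ output y := List.filterMap_append

@[simp] theorem ops_append (k : K) (x y : List (Event α K)) :
    ops k (x ++ y) = ops k x ++ ops k y := List.filterMap_append

@[simp] theorem output_out (o : Option α) (x : List (Event α K)) :
    output (out o :: x) = o.toList ++ output x := by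
  cases o <;> simp [output, label, List.filterMap_cons]

@[simp] theorem output_op (k : K) (b : Bool) (x : List (Event α K)) :
    output (op k b :: x) = output x := by simp [output, label, List.filterMap_cons]

@[simp] theorem ops_out (k : K) (o : Option α) (x : List (Event α K)) :
    ops k (out o :: x) = ops k x := by simp [ops, opOn, List.filterMap_cons]

@[simp] theorem ops_op_self (k : K) (b : Bool) (x : List (Event α K)) :
    ops k (op k b :: x) = b :: ops k x := by simp [ops, opOn]

theorem ops_op_of_ne {k k' : K} (h : k' ≠ k) (b : Bool) (x : List (Event α K)) :
    ops k (op k' b :: x) = ops k x := by simp [ops, opOn, h]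

@[simp] theorem ops_inl_op_inr (k : K₁) (k' : K₂) (b : Bool) (x : List (Event α (K₁ ⊕ K₂))) :
    ops (.inl k) (op (.inr k') b :: x) = ops (.inl k) x := ops_op_of_ne (by simp) b x

@[simp] theorem ops_inr_op_inl (k : K₁) (k' : K₂) (b : Bool) (x : List (Event α (K₁ ⊕ K₂))) :
    ops (.inr k') (op (.inl k) b :: x) = ops (.inr k') x := ops_op_of_ne (by simp) b x

@[simp] theorem output_map_id (φ : K → K') (x : List (Event α K)) :
    output (x.map (map id φ)) = output x := by
  induction x with
  | nil => rfl
  | cons e x ih => cases e <;> simp [map, ih]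

@[simp] theorem output_map_none (φ : K → K') (x : List (Event α K)) :
    output (x.map (map (fun _ => none) φ)) = [] := by
  induction x with
  | nil => rfl
  | cons e x ih => cases e <;> simp [map, ih]

@[simp] theorem ops_inl_map_inl (g : Option α → Option α) (k : K₁) (x : List (Event α K₁)) :
    ops (.inl k) (x.map (map g (.inl : K₁ → K₁ ⊕ K₂))) = ops k x := by
  induction x with
  | nil => rfl
  | cons e x ih =>
    cases e with
    | out o => simp [map, ih]
    | op k' b =>
      by_cases h : k' = k
      · subst h; simp [map, ih]
      · rw [ops_op_of_ne h, List.map_cons, map, ops_op_of_ne (by simpa using h), ih]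

@[simp] theorem ops_inr_map_inr (g : Option α → Option α) (k : K₂) (x : List (Event α K₂)) :
    ops (.inr k) (x.map (map g (.inr : K₂ → K₁ ⊕ K₂))) = ops k x := by
  induction x with
  | nil => rfl
  | cons e x ih =>
    cases e with
    | out o => simp [map, ih]
    | op k' b =>
      by_cases h : k' = k
      · subst h; simp [map, ih]
      · rw [ops_op_of_ne h, List.map_cons, map, ops_op_of_ne (by simpa using h), ih]

@[simp] theorem ops_inr_map_inl (g : Option α → Option α) (k : K₂) (x : List (Event α K₁)) :
    ops (.inr k) (x.map (map g (.inl : K₁ → K₁ ⊕ K₂))) = [] := by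
  induction x with
  | nil => rfl
  | cons e x ih => cases e <;> simp [map, ih]

@[simp] theorem ops_inl_map_inr (g : Option α → Option α) (k : K₁) (x : List (Event α K₂)) :
    ops (.inl k) (x.map (map g (.inr : K₂ → K₁ ⊕ K₂))) = [] := by
  induction x with
  | nil => rfl
  | cons e x ih => cases e <;> simp [map, ih]

theorem output_block (y : ℕ → List (Event α K)) (a b : ℕ) :
    output (block y a b) = block (fun i => output (y i)) a b :=
  apply_block rfl output_append y a b

theorem ops_block (k : K) (y : ℕ → List (Event α K)) (a b : ℕ) :
    ops k (block y a b) = block (fun i => ops k (y i)) a b :=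
  apply_block rfl (ops_append k) y a b

end Event

open Event

/-! ### Languages of word sequences given by event words -/

section SeqLang

variable {α : Type u} {K K₁ K₂ : Type}

/-- The sequences of outputs of event words taken from the languages `Z i`, where every counter
checks infinitely many values infinitely often. -/
def seqLang (Z : ℕ → Language (Event α K)) : Set (ℕ → List α) :=
  {u | ∃ y : ℕ → List (Event α K), (∀ i, y i ∈ Z i) ∧ (∀ k, InfChecks fun i => ops k (y i)) ∧
    ∀ i, u i = output (y i)}

/-- The concatenation of two languages of event words with separate counters, where the outputs
are changed by `g₁` and `g₂`, respectively. -/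
def juxtapose (g₁ g₂ : Option α → Option α) (X₁ : Language (Event α K₁))
    (X₂ : Language (Event α K₂)) : Language (Event α (K₁ ⊕ K₂)) :=
  Language.map (map g₁ .inl) X₁ * Language.map (map g₂ .inr) X₂

theorem mem_juxtapose {g₁ g₂ : Option α → Option α} {X₁ : Language (Event α K₁)}
    {X₂ : Language (Event α K₂)} {x : List (Event α (K₁ ⊕ K₂))} :
    x ∈ juxtapose g₁ g₂ X₁ X₂ ↔
      ∃ x₁ ∈ X₁, ∃ x₂ ∈ X₂, x = x₁.map (map g₁ .inl) ++ x₂.map (map g₂ .inr) := by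
  constructor
  · intro h
    obtain ⟨_, ⟨x₁, h₁, rfl⟩, _, ⟨x₂, h₂, rfl⟩, rfl⟩ := Language.mem_mul.1 h
    exact ⟨x₁, h₁, x₂, h₂, rfl⟩
  · rintro ⟨x₁, h₁, x₂, h₂, rfl⟩
    exact Language.mem_mul.2 ⟨_, ⟨x₁, h₁, rfl⟩, _, ⟨x₂, h₂, rfl⟩, rfl⟩

theorem isRegular_juxtapose (g₁ g₂ : Option α → Option α) {X₁ : Language (Event α K₁)}
    {X₂ : Language (Event α K₂)} (h₁ : X₁.IsRegular) (h₂ : X₂.IsRegular) :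
    (juxtapose g₁ g₂ X₁ X₂).IsRegular :=
  isRegular_mul (isRegular_map _ h₁) (isRegular_map _ h₂)

/-! ### Operations on event languages and their effect on word sequences -/

theorem mem_seqLang_juxtapose {Z₁ : ℕ → Language (Event α K₁)} {Z₂ : ℕ → Language (Event α K₂)}
    {w : ℕ → List α} :
    w ∈ seqLang (fun i => juxtapose id id (Z₁ i) (Z₂ i)) ↔
      ∃ u ∈ seqLang Z₁, ∃ v ∈ seqLang Z₂, ∀ i, w i = u i ++ v i := by
  constructor
  · rintro ⟨y, hy, hc, hw⟩
    simp only [mem_juxtapose] at hy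
    choose y₁ h₁ y₂ h₂ he using hy
    obtain rfl := funext he
    refine ⟨_, ⟨y₁, h₁, fun k => ?_, fun i => rfl⟩, _, ⟨y₂, h₂, fun k => ?_, fun i => rfl⟩,
      fun i => ?_⟩
    · simpa using hc (.inl k)
    · simpa using hc (.inr k)
    · simp [hw]
  · rintro ⟨u, ⟨y₁, h₁, c₁, hu⟩, v, ⟨y₂, h₂, c₂, hv⟩, hw⟩
    refine ⟨_, fun i => mem_juxtapose.2 ⟨y₁ i, h₁ i, y₂ i, h₂ i, rfl⟩, ?_, fun i => ?_⟩
    · rintro (k | k)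
      · simpa using c₁ k
      · simpa using c₂ k
    · simp [hw, hu, hv]

/-- The words of counter operations. -/
def silent (α : Type u) (K : Type) : Language (Event α K) :=
  wordsOver fun e => ∃ k b, e = op k b

theorem isRegular_silent : (silent α K).IsRegular := isRegular_wordsOver _

theorem output_of_mem_silent {x : List (Event α K)} (hx : x ∈ silent α K) : output x = [] := by
  induction x with
  | nil => rfl
  | cons e x ih =>
    obtain ⟨k, b, rfl⟩ := hx e (by simp)
    rw [output_op]
    exact ih fun e he => hx e (by simp [he])

theorem ops_flatMap (l : List K) (hl : l.Nodup) (c : ℕ) (k : K) (hk : k ∈ l) :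
    ops k (l.flatMap fun k' => List.replicate c (op k' true : Event α K) ++ [op k' false]) =
      List.replicate c true ++ [false] := by
  have h1 : ∀ k' : K, k' ≠ k →
      ops k (List.replicate c (op k' true : Event α K) ++ [op k' false]) = [] := by
    intro k' h
    rw [ops_append, ops_op_of_ne h, ops_nil, List.append_nil]
    induction c with
    | zero => rfl
    | succ c ih => rw [List.replicate_succ, ops_op_of_ne h, ih]
  have h2 : ops k (List.replicate c (op k true : Event α K) ++ [op k false]) =
      List.replicate c true ++ [false] := by
    rw [ops_append, ops_op_self, ops_nil]
    congr 1
    clear h1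
    induction c with
    | zero => rfl
    | succ c ih => simp [List.replicate_succ, ih]
  have h3 : ∀ l : List K, k ∉ l →
      ops k (l.flatMap fun k' => List.replicate c (op k' true : Event α K) ++ [op k' false]) =
        [] := by
    intro l
    induction l with
    | nil => intro _; rfl
    | cons k' l ih =>
      intro h
      rw [List.mem_cons, not_or] at h
      rw [List.flatMap_cons, ops_append, h1 k' (Ne.symm h.1), ih h.2, List.append_nil]
  induction l with
  | nil => simp at hk
  | cons k' l ih =>
    rw [List.nodup_cons] at hl
    rw [List.flatMap_cons, ops_append]
    by_cases h : k' = k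
    · subst h
      rw [h2, h3 l hl.1, List.append_nil]
    · rw [h1 k' h, ih hl.2 ((List.mem_cons.1 hk).resolve_left (Ne.symm h)), List.nil_append]

/-- Free counters can always be satisfied silently: the `i`-th word raises each counter in turn to
the first coordinate of `Nat.unpair i` and checks it. This permits padding with unused counters. -/
theorem seqLang_silent [Finite K] :
    seqLang (fun _ => silent α K) = {fun _ => []} := by
  ext u
  constructor
  · rintro ⟨y, hy, -, hu⟩
    refine funext fun i => ?_
    rw [hu, output_of_mem_silent (hy i)]
  · rintro rfl
    have := Fintype.ofFinite K
    have hy : ∀ i : ℕ, ((Finset.univ : Finset K).toList.flatMap fun k' =>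
        List.replicate (Nat.unpair i).1 (op k' true : Event α K) ++ [op k' false]) ∈
          silent α K := by
      intro i e he
      obtain ⟨k, -, h⟩ := List.mem_flatMap.1 he
      rcases List.mem_append.1 h with h | h
      · exact ⟨k, true, List.eq_of_mem_replicate h⟩
      · exact ⟨k, false, List.mem_singleton.1 h⟩
    refine ⟨_, hy, fun k => ?_, fun i => (output_of_mem_silent (hy i)).symm⟩
    simp only [ops_flatMap _ (Finset.nodup_toList _) _ k (Finset.mem_toList.2 (Finset.mem_univ k))]
    exact (infChecks_replicate_iff _).2 (infinite_setOf_unpair_fst 0)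

theorem seqLang_juxtapose_silent [Finite K₂] (Z : ℕ → Language (Event α K₁)) :
    seqLang (fun i => juxtapose id id (Z i) (silent α K₂)) = seqLang Z := by
  ext w
  simp only [mem_seqLang_juxtapose, seqLang_silent, Set.mem_singleton_iff, exists_eq_left,
    List.append_nil]
  exact ⟨fun ⟨u, hu, h⟩ => (funext h : w = u) ▸ hu, fun h => ⟨w, h, fun _ => rfl⟩⟩

theorem seqLang_silent_juxtapose [Finite K₁] (Z : ℕ → Language (Event α K₂)) :
    seqLang (fun i => juxtapose id id (silent α K₁) (Z i)) = seqLang Z := by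
  ext w
  simp only [mem_seqLang_juxtapose, seqLang_silent, Set.mem_singleton_iff, exists_eq_left,
    List.nil_append]
  exact ⟨fun ⟨u, hu, h⟩ => (funext h : w = u) ▸ hu, fun h => ⟨w, h, fun _ => rfl⟩⟩

/-- Both operands must be valid sequences at all positions, including those where the other one
supplies the word. Hence both event words are kept with their counter operations and only one output
is erased. -/
theorem mem_seqLang_mix {X₁ : Language (Event α K₁)} {X₂ : Language (Event α K₂)}
    {w : ℕ → List α} :
    w ∈ seqLang (fun _ => juxtapose id (fun _ => none) X₁ X₂ +
        juxtapose (fun _ => none) id X₁ X₂) ↔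
      ∃ u ∈ seqLang (fun _ => X₁), ∃ v ∈ seqLang (fun _ => X₂), ∀ i, w i = u i ∨ w i = v i := by
  constructor
  · rintro ⟨y, hy, hc, hw⟩
    have hy' : ∀ i, ∃ x₁ ∈ X₁, ∃ x₂ ∈ X₂, (∀ k, ops (.inl k) (y i) = ops k x₁) ∧
        (∀ k, ops (.inr k) (y i) = ops k x₂) ∧ (w i = output x₁ ∨ w i = output x₂) := by
      intro i
      rcases (Language.mem_add _ _ _).1 (hy i) with h | h <;>
      · obtain ⟨x₁, h₁, x₂, h₂, he⟩ := mem_juxtapose.1 h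
        exact ⟨x₁, h₁, x₂, h₂, by simp [he], by simp [he], by simp [hw, he]⟩
    choose y₁ h₁ y₂ h₂ o₁ o₂ ho using hy'
    refine ⟨_, ⟨y₁, h₁, fun k => ?_, fun i => rfl⟩, _, ⟨y₂, h₂, fun k => ?_, fun i => rfl⟩, ho⟩
    · simpa [o₁] using hc (.inl k)
    · simpa [o₂] using hc (.inr k)
  · rintro ⟨u, ⟨y₁, h₁, c₁, hu⟩, v, ⟨y₂, h₂, c₂, hv⟩, hw⟩
    have hy : ∀ i, ∃ y ∈ juxtapose id (fun _ => none) X₁ X₂ +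
        juxtapose (fun _ => none) id X₁ X₂, (∀ k, ops (.inl k) y = ops k (y₁ i)) ∧
        (∀ k, ops (.inr k) y = ops k (y₂ i)) ∧ w i = output y := by
      intro i
      rcases hw i with h | h
      · exact ⟨_, (Language.mem_add _ _ _).2
          (.inl (mem_juxtapose.2 ⟨_, h₁ i, _, h₂ i, rfl⟩)), by simp, by simp, by simp [h, hu]⟩
      · exact ⟨_, (Language.mem_add _ _ _).2
          (.inr (mem_juxtapose.2 ⟨_, h₁ i, _, h₂ i, rfl⟩)), by simp, by simp, by simp [h, hv]⟩
    choose y hy o₁ o₂ ho using hy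
    refine ⟨y, hy, ?_, ho⟩
    rintro (k | k)
    · simpa [o₁] using c₁ k
    · simpa [o₂] using c₂ k

/-- Each list of words is read as a word over the alphabet of words, and the lists are concatenated.
Infinitely many nonempty lists are needed for the concatenation to be infinite and the cut
unbounded. -/
theorem exists_cut_of_forall_mem {β : Type v} {X : Set (List β)} {l : ℕ → List (List β)}
    (hX : ∀ i, ∀ x ∈ l i, x ∈ X) (hl : ∀ m, ∃ i ≥ m, l i ≠ []) :
    ∃ (x : ℕ → List β) (f : ℕ → ℕ), IsCut f ∧ (∀ n, x n ∈ X) ∧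
      ∀ i, l i = (List.range' (f i) (f (i + 1) - f i)).map x := by
  obtain ⟨x, hx⟩ := exists_isConcat hl
  obtain ⟨f, hf, h⟩ := hx.exists_cut
  refine ⟨x, f, hf, fun n => ?_, fun i => by rw [h i, block_singleton]⟩
  obtain ⟨N, hN⟩ := hx.1 n
  have hmem : x n ∈ block l 0 N := by
    rw [hx.2 N n hN]
    exact List.getElem_mem hN
  obtain ⟨t, ht, hxt⟩ := List.mem_flatten.1 hmem
  obtain ⟨i, -, rfl⟩ := List.mem_map.1 ht
  exact hX i _ hxt

/-- A counter is needed: its condition excludes that the factorizations are eventually empty, which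
makes the cut unbounded. Without counters the constant sequence of empty words would always belong
to the left side. -/
theorem mem_seqLang_kstar [Nonempty K] {X : Language (Event α K)} {w : ℕ → List α} :
    w ∈ seqLang (fun _ => KStar.kstar X) ↔
      ∃ u ∈ seqLang (fun _ => X), ∃ f, IsCut f ∧ ∀ i, w i = block u (f i) (f (i + 1)) := by
  constructor
  · rintro ⟨y, hy, hc, hw⟩
    choose l hl hX using hy
    obtain ⟨k⟩ := ‹Nonempty K›
    obtain ⟨x, f, hf, hxX, hlx⟩ := exists_cut_of_forall_mem hX fun m => by
      obtain ⟨i, hi, hne⟩ := (hc k).exists_ne_nil m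
      refine ⟨i, hi, fun h => hne ?_⟩
      rw [hl, h]; rfl
    have hyx : ∀ i, y i = block x (f i) (f (i + 1)) := fun i => by rw [hl, hlx]; rfl
    refine ⟨_, ⟨x, hxX, fun k => ?_, fun i => rfl⟩, f, hf, fun i => ?_⟩
    · simpa only [hyx, ops_block, hf.infChecks_iff] using hc k
    · rw [hw, hyx, output_block]
  · rintro ⟨u, ⟨x, hx, hc, hu⟩, f, hf, hw⟩
    refine ⟨fun i => block x (f i) (f (i + 1)), fun i => ?_, fun k => ?_, fun i => ?_⟩
    · refine Language.join_mem_kstar fun t ht => ?_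
      obtain ⟨n, -, rfl⟩ := List.mem_map.1 ht
      exact hx n
    · simpa only [ops_block, hf.infChecks_iff] using hc k
    · rw [hw, output_block]
      exact block_congr fun i _ _ => hu i

/-- Blocks of words from `X`, whose numbers of words are counted by a new counter. -/
def counted (X : Language (Event α K)) : Language (Event α (K ⊕ Unit)) :=
  KStar.kstar (Language.map (map id .inl) X * ({[op (.inr ()) true]} : Language _)) *
    ({[op (.inr ()) false]} : Language _)

theorem isRegular_counted {X : Language (Event α K)} (hX : X.IsRegular) :
    (counted X).IsRegular :=
  isRegular_mul (isRegular_kstar (isRegular_mul (isRegular_map _ hX)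
    (isRegular_singleton_letter _))) (isRegular_singleton_letter _)

/-- The concatenation of the words in `l`, where a new counter is incremented after each of them
and checked at the end. -/
def countedWord (l : List (List (Event α K))) : List (Event α (K ⊕ Unit)) :=
  (l.map fun x => x.map (map id .inl) ++ [op (.inr ()) true]).flatten ++ [op (.inr ()) false]

theorem mem_counted {X : Language (Event α K)} {y : List (Event α (K ⊕ Unit))} :
    y ∈ counted X ↔ ∃ l : List (List (Event α K)), (∀ x ∈ l, x ∈ X) ∧
      y = countedWord l := by
  constructor
  · intro h
    obtain ⟨_, ⟨l, rfl, hl⟩, _, rfl, rfl⟩ := Language.mem_mul.1 h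
    have : ∃ l' : List (List (Event α K)), (∀ x ∈ l', x ∈ X) ∧
        l = l'.map fun x => x.map (map id .inl) ++ [op (.inr ()) true] := by
      induction l with
      | nil => exact ⟨[], by simp, rfl⟩
      | cons t l ih =>
        obtain ⟨l', h1, rfl⟩ := ih (fun y hy => hl y (by simp [hy]))
          (Language.append_mem_mul (Language.join_mem_kstar fun y hy => hl y (by simp [hy])) rfl)
        obtain ⟨_, ⟨x, hx, rfl⟩, _, rfl, rfl⟩ := Language.mem_mul.1 (hl t (by simp))
        exact ⟨x :: l', by simpa using ⟨hx, h1⟩, rfl⟩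
    obtain ⟨l', h1, rfl⟩ := this
    exact ⟨l', h1, rfl⟩
  · rintro ⟨l, hl, rfl⟩
    refine Language.append_mem_mul (Language.join_mem_kstar fun t ht => ?_) rfl
    obtain ⟨x, hx, rfl⟩ := List.mem_map.1 ht
    exact Language.append_mem_mul ⟨x, hl x hx, rfl⟩ rfl

theorem ops_inl_countedWord (k : K) (l : List (List (Event α K))) :
    ops (.inl k) (countedWord l) = ops k l.flatten := by
  unfold countedWord
  induction l with
  | nil => simp
  | cons x l ih => simp at ih ⊢; exact ih

theorem ops_inr_countedWord (t : Unit) (l : List (List (Event α K))) :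
    ops (.inr t) (countedWord l) = List.replicate l.length true ++ [false] := by
  cases t
  unfold countedWord
  induction l with
  | nil => simp
  | cons x l ih => simp [List.replicate_succ] at ih ⊢; exact ih

theorem output_countedWord (l : List (List (Event α K))) :
    output (countedWord l) = output l.flatten := by
  unfold countedWord
  induction l with
  | nil => simp
  | cons x l ih => simp at ih ⊢; exact ih

theorem mem_seqLang_counted {X : Language (Event α K)} {w : ℕ → List α} :
    w ∈ seqLang (fun _ => counted X) ↔
      ∃ u ∈ seqLang (fun _ => X), ∃ f, IsCut f ∧
        {n : ℕ | ∀ k : ℕ, ∃ i > k, f (i + 1) - f i = n}.Infinite ∧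
        ∀ i, w i = block u (f i) (f (i + 1)) := by
  constructor
  · rintro ⟨y, hy, hc, hw⟩
    simp only [mem_counted] at hy
    choose l hX hl using hy
    have hlen := hc (.inr ())
    simp only [hl, ops_inr_countedWord, infChecks_replicate_iff] at hlen
    obtain ⟨x, f, hf, hxX, hlx⟩ := exists_cut_of_forall_mem hX fun m => by
      -- Some positive block length recurs infinitely often, so the new counter itself guarantees
      -- that the cut is unbounded.
      obtain ⟨n, hn, hn0⟩ := hlen.exists_gt 0
      obtain ⟨i, hi, hin⟩ := hn m
      refine ⟨i, hi.le, fun h => ?_⟩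
      rw [h, List.length_nil] at hin
      omega
    have hfl : ∀ i, (l i).flatten = block x (f i) (f (i + 1)) := fun i => by rw [hlx]; rfl
    refine ⟨_, ⟨x, hxX, fun k => ?_, fun i => rfl⟩, f, hf, ?_, fun i => ?_⟩
    · simpa only [hl, ops_inl_countedWord, hfl, ops_block, hf.infChecks_iff] using hc (.inl k)
    · simpa [hlx] using hlen
    · rw [hw, hl, output_countedWord, hfl, output_block]
  · rintro ⟨u, ⟨x, hx, hc, hu⟩, f, hf, hT, hw⟩
    refine ⟨_, fun i => mem_counted.2
      ⟨(List.range' (f i) (f (i + 1) - f i)).map x, ?_, rfl⟩, ?_, fun i => ?_⟩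
    · intro t ht
      obtain ⟨n, -, rfl⟩ := List.mem_map.1 ht
      exact hx n
    · rintro (k | k)
      · simp only [ops_inl_countedWord]
        change InfChecks fun i => ops k (block x (f i) (f (i + 1)))
        simpa only [ops_block, hf.infChecks_iff] using hc k
      · simpa only [ops_inr_countedWord, infChecks_replicate_iff, List.length_map,
          List.length_range'] using hT
    · rw [output_countedWord, hw]
      refine Eq.trans ?_ (output_block x (f i) (f (i + 1))).symm
      exact block_congr fun i _ _ => hu i

end SeqLang

/-! ### Recognizable languages of word sequences -/

section Recognizable

variable {α : Type u}

/-- Finite unions of languages of word sequences given by regular languages of event words. -/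
def IsSeqRecognizable (L : Set (ℕ → List α)) : Prop :=
  ∃ (J K : Type) (_ : Finite J) (_ : Finite K) (X : J → Language (Event α K)),
    (∀ j, (X j).IsRegular) ∧ ∀ u, u ∈ L ↔ ∃ j, u ∈ seqLang fun _ => X j

/-! ### Closure of recognizable sequence languages under the operations of `T`-regular expressions
-/

theorem isSeqRecognizable_empty : IsSeqRecognizable (∅ : Set (ℕ → List α)) :=
  ⟨Empty, Empty, inferInstance, inferInstance, fun _ => 0, nofun, fun u => by simp⟩

theorem isSeqRecognizable_letter (a : α) :
    IsSeqRecognizable ({fun _ => [a]} : Set (ℕ → List α)) := by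
  refine ⟨Unit, Empty, inferInstance, inferInstance, fun _ => ({[out (some a)]} : Language _),
    fun _ => isRegular_singleton_letter _, fun u => ⟨?_, ?_⟩⟩
  · rintro rfl
    exact ⟨(), fun _ => [out (some a)], fun _ => rfl, nofun, fun _ => by simp⟩
  · rintro ⟨_, y, hy, -, hu⟩
    refine funext fun i => ?_
    rw [hu, show y i = [out (some a)] from hy i]
    simp

theorem IsSeqRecognizable.concat {L₁ L₂ : Set (ℕ → List α)} (h₁ : IsSeqRecognizable L₁)
    (h₂ : IsSeqRecognizable L₂) :
    IsSeqRecognizable {w | ∃ u ∈ L₁, ∃ v ∈ L₂, ∀ i, w i = u i ++ v i} := by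
  obtain ⟨J₁, K₁, _, _, X₁, r₁, h₁⟩ := h₁
  obtain ⟨J₂, K₂, _, _, X₂, r₂, h₂⟩ := h₂
  refine ⟨J₁ × J₂, K₁ ⊕ K₂, inferInstance, inferInstance,
    fun j => juxtapose id id (X₁ j.1) (X₂ j.2),
    fun j => isRegular_juxtapose _ _ (r₁ j.1) (r₂ j.2), fun w => ?_⟩
  simp only [mem_seqLang_juxtapose, Set.mem_ofPred_eq, h₁, h₂, Prod.exists]
  exact ⟨fun ⟨u, ⟨j, hu⟩, v, ⟨j', hv⟩, h⟩ => ⟨j, j', u, hu, v, hv, h⟩,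
    fun ⟨j, j', u, hu, v, hv, h⟩ => ⟨u, ⟨j, hu⟩, v, ⟨j', hv⟩, h⟩⟩

theorem IsSeqRecognizable.mix {L₁ L₂ : Set (ℕ → List α)} (h₁ : IsSeqRecognizable L₁)
    (h₂ : IsSeqRecognizable L₂) :
    IsSeqRecognizable {w | ∃ u ∈ L₁, ∃ v ∈ L₂, ∀ i, w i = u i ∨ w i = v i} := by
  obtain ⟨J₁, K₁, _, _, X₁, r₁, h₁⟩ := h₁
  obtain ⟨J₂, K₂, _, _, X₂, r₂, h₂⟩ := h₂
  refine ⟨J₁ × J₂, K₁ ⊕ K₂, inferInstance, inferInstance,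
    fun j => juxtapose id (fun _ => none) (X₁ j.1) (X₂ j.2) +
      juxtapose (fun _ => none) id (X₁ j.1) (X₂ j.2),
    fun j => (isRegular_juxtapose _ _ (r₁ j.1) (r₂ j.2)).add
      (isRegular_juxtapose _ _ (r₁ j.1) (r₂ j.2)), fun w => ?_⟩
  simp only [mem_seqLang_mix, Set.mem_ofPred_eq, h₁, h₂, Prod.exists]
  exact ⟨fun ⟨u, ⟨j, hu⟩, v, ⟨j', hv⟩, h⟩ => ⟨j, j', u, hu, v, hv, h⟩,
    fun ⟨j, j', u, hu, v, hv, h⟩ => ⟨u, ⟨j, hu⟩, v, ⟨j', hv⟩, h⟩⟩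

/-- The two families are brought to the common counter set `K₁ ⊕ K₂` by silent padding; the index
sets are then simply joined. -/
theorem IsSeqRecognizable.union {L₁ L₂ : Set (ℕ → List α)} (h₁ : IsSeqRecognizable L₁)
    (h₂ : IsSeqRecognizable L₂) : IsSeqRecognizable (L₁ ∪ L₂) := by
  obtain ⟨J₁, K₁, _, _, X₁, r₁, h₁⟩ := h₁
  obtain ⟨J₂, K₂, _, _, X₂, r₂, h₂⟩ := h₂
  refine ⟨J₁ ⊕ J₂, K₁ ⊕ K₂, inferInstance, inferInstance,
    Sum.elim (fun j => juxtapose id id (X₁ j) (silent α K₂))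
      (fun j => juxtapose id id (silent α K₁) (X₂ j)), ?_, fun w => ?_⟩
  · rintro (j | j)
    · exact isRegular_juxtapose _ _ (r₁ j) isRegular_silent
    · exact isRegular_juxtapose _ _ isRegular_silent (r₂ j)
  · simp only [Set.mem_union, h₁, h₂, Sum.exists, Sum.elim_inl, Sum.elim_inr,
      seqLang_juxtapose_silent, seqLang_silent_juxtapose]

theorem IsSeqRecognizable.star {L : Set (ℕ → List α)} (h : IsSeqRecognizable L) :
    IsSeqRecognizable
      {w | ∃ u ∈ L, ∃ f : ℕ → ℕ, IsCut f ∧ ∀ i, w i = block u (f i) (f (i + 1))} := by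
  obtain ⟨J, K, _, _, X, r, h⟩ := h
  -- The silent extra counter makes the counter set nonempty, as `mem_seqLang_kstar` requires,
  -- without changing the sequences.
  refine ⟨J, K ⊕ Unit, inferInstance, inferInstance,
    fun j => KStar.kstar (juxtapose id id (X j) (silent α Unit)),
    fun j => isRegular_kstar (isRegular_juxtapose _ _ (r j) isRegular_silent), fun w => ?_⟩
  simp only [mem_seqLang_kstar, Set.mem_ofPred_eq, h, seqLang_juxtapose_silent]
  exact ⟨fun ⟨u, ⟨j, hu⟩, h⟩ => ⟨j, u, hu, h⟩, fun ⟨j, u, hu, h⟩ => ⟨u, ⟨j, hu⟩, h⟩⟩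

theorem IsSeqRecognizable.texp {L : Set (ℕ → List α)} (h : IsSeqRecognizable L) :
    IsSeqRecognizable
      {w | ∃ u ∈ L, ∃ f : ℕ → ℕ, IsCut f ∧
        {n : ℕ | ∀ k : ℕ, ∃ i > k, f (i + 1) - f i = n}.Infinite ∧
        ∀ i, w i = block u (f i) (f (i + 1))} := by
  obtain ⟨J, K, _, _, X, r, h⟩ := h
  refine ⟨J, K ⊕ Unit, inferInstance, inferInstance, fun j => counted (X j),
    fun j => isRegular_counted (r j), fun w => ?_⟩
  simp only [mem_seqLang_counted, Set.mem_ofPred_eq, h]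
  exact ⟨fun ⟨u, ⟨j, hu⟩, h⟩ => ⟨j, u, hu, h⟩, fun ⟨j, u, hu, h⟩ => ⟨u, ⟨j, hu⟩, h⟩⟩

theorem TRegExp.isSeqRecognizable (e : TRegExp α) : IsSeqRecognizable e.lang := by
  induction e with
  | empty => exact isSeqRecognizable_empty
  | letter a => exact isSeqRecognizable_letter a
  | concat e₁ e₂ h₁ h₂ => exact h₁.concat h₂
  -- Both sequences mixed by `+` may come from either operand, so the union is mixed with itself.
  | plus e₁ e₂ h₁ h₂ => exact (h₁.union h₂).mix (h₁.union h₂)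
  | star e h => exact h.star
  | texp e h => exact h.texp

/-- The sequence of languages `Y, X, X, X, …`. -/
def headTail {β : Type v} (Y X : β) : ℕ → β
  | 0 => Y
  | _ + 1 => X

/-- Finite unions of languages of `ω`-words obtained by concatenating the outputs of a first event
word from a regular language and further event words from another regular language. -/
def IsOmegaRecognizable (W : Set (ℕ → α)) : Prop :=
  ∃ (J K : Type) (_ : Finite J) (_ : Finite K) (Y X : J → Language (Event α K)),
    (∀ j, (Y j).IsRegular) ∧ (∀ j, (X j).IsRegular) ∧
      ∀ w, w ∈ W ↔ ∃ j, ∃ u ∈ seqLang (headTail (Y j) (X j)), IsConcat w u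

/-! ### Closure of recognizable `ω`-languages -/

theorem IsSeqRecognizable.isOmegaRecognizable {L : Set (ℕ → List α)} (h : IsSeqRecognizable L) :
    IsOmegaRecognizable {w | ∃ u ∈ L, IsConcat w u} := by
  obtain ⟨J, K, _, _, X, r, h⟩ := h
  refine ⟨J, K, inferInstance, inferInstance, X, X, r, r, fun w => ?_⟩
  have key : ∀ j, headTail (X j) (X j) = fun _ => X j := fun j => by
    funext i; cases i <;> rfl
  simp only [key, Set.mem_ofPred_eq, h]
  exact ⟨fun ⟨u, ⟨j, hu⟩, h⟩ => ⟨j, u, hu, h⟩, fun ⟨j, u, hu, h⟩ => ⟨u, ⟨j, hu⟩, h⟩⟩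

theorem IsOmegaRecognizable.union {W₁ W₂ : Set (ℕ → α)} (h₁ : IsOmegaRecognizable W₁)
    (h₂ : IsOmegaRecognizable W₂) : IsOmegaRecognizable (W₁ ∪ W₂) := by
  obtain ⟨J₁, K₁, _, _, Y₁, X₁, s₁, r₁, h₁⟩ := h₁
  obtain ⟨J₂, K₂, _, _, Y₂, X₂, s₂, r₂, h₂⟩ := h₂
  refine ⟨J₁ ⊕ J₂, K₁ ⊕ K₂, inferInstance, inferInstance,
    Sum.elim (fun j => juxtapose id id (Y₁ j) (silent α K₂))
      (fun j => juxtapose id id (silent α K₁) (Y₂ j)),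
    Sum.elim (fun j => juxtapose id id (X₁ j) (silent α K₂))
      (fun j => juxtapose id id (silent α K₁) (X₂ j)), ?_, ?_, fun w => ?_⟩
  · rintro (j | j)
    · exact isRegular_juxtapose _ _ (s₁ j) isRegular_silent
    · exact isRegular_juxtapose _ _ isRegular_silent (s₂ j)
  · rintro (j | j)
    · exact isRegular_juxtapose _ _ (r₁ j) isRegular_silent
    · exact isRegular_juxtapose _ _ isRegular_silent (r₂ j)
  · have e₁ : ∀ j, seqLang (headTail (juxtapose id id (Y₁ j) (silent α K₂))
        (juxtapose id id (X₁ j) (silent α K₂))) = seqLang (headTail (Y₁ j) (X₁ j)) := fun j => by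
      rw [← seqLang_juxtapose_silent (K₂ := K₂) (headTail (Y₁ j) (X₁ j))]
      congr 1; funext i; cases i <;> rfl
    have e₂ : ∀ j, seqLang (headTail (juxtapose id id (silent α K₁) (Y₂ j))
        (juxtapose id id (silent α K₁) (X₂ j))) = seqLang (headTail (Y₂ j) (X₂ j)) := fun j => by
      rw [← seqLang_silent_juxtapose (K₁ := K₁) (headTail (Y₂ j) (X₂ j))]
      congr 1; funext i; cases i <;> rfl
    simp only [Set.mem_union, h₁, h₂, Sum.exists, Sum.elim_inl, Sum.elim_inr, e₁, e₂]

theorem output_map_out {K : Type} (x : List α) :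
    output (x.map fun a => (out (some a) : Event α K)) = x := by
  induction x with
  | nil => rfl
  | cons a x ih => simp [ih]

theorem ops_map_out {K : Type} (k : K) (x : List α) :
    ops k (x.map fun a => (out (some a) : Event α K)) = [] := by
  induction x with
  | nil => rfl
  | cons a x ih => simp [ih]

/-- A word of `R` is put out before the first event word. It contains no counter operations, so only
the language of the first word changes. -/
theorem IsOmegaRecognizable.prefix {R : Language α} (hR : R.IsRegular) {W : Set (ℕ → α)}
    (h : IsOmegaRecognizable W) :
    IsOmegaRecognizable {w | ∃ x ∈ R, ∃ v ∈ W, w = appendWord x v} := by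
  obtain ⟨J, K, _, _, Y, X, s, r, h⟩ := h
  refine ⟨J, K, inferInstance, inferInstance,
    fun j => Language.map (fun a => out (some a)) R * Y j, X,
    fun j => isRegular_mul (isRegular_map _ hR) (s j), r, fun w => ?_⟩
  simp only [Set.mem_ofPred_eq, h]
  constructor
  · rintro ⟨x, hx, v, ⟨j, u, ⟨y, hy, hc, hu⟩, hv⟩, rfl⟩
    refine ⟨j, _, ⟨fun i => (if i = 0 then x.map fun a => out (some a) else []) ++ y i,
      fun i => ?_, fun k => ?_, fun i => rfl⟩, ?_⟩
    · cases i with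
      | zero => exact Language.append_mem_mul ⟨x, hx, rfl⟩ (hy 0)
      | succ i => exact hy (i + 1)
    · convert hc k using 2 with i
      dsimp only
      split_ifs <;> simp [ops_map_out]
    · refine (isConcat_cons_append_iff (r := x) (u := u) ?_ fun i => ?_).2 ⟨v, rfl, hv⟩
      · simp [output_map_out, hu]
      · simp [hu]
  · rintro ⟨j, u, ⟨y, hy, hc, hu⟩, hw⟩
    obtain ⟨_, ⟨x, hx, rfl⟩, y₀, hy₀, h₀⟩ := Language.mem_mul.1 (hy 0)
    have hy' : ∀ i, y i = (if i = 0 then x.map fun a => out (some a) else []) ++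
        (if i = 0 then y₀ else y i) := by
      intro i
      split_ifs with hi
      · subst hi; exact h₀.symm
      · rfl
    obtain ⟨v, rfl, hv⟩ := (isConcat_cons_append_iff (r := x)
      (u := fun i => output (if i = 0 then y₀ else y i)) (v := u)
      (by rw [hu, hy']; simp [output_map_out]) fun i => by simp [hu]).1 hw
    refine ⟨x, hx, v, ⟨j, _, ⟨_, fun i => ?_, fun k => ?_, fun i => rfl⟩, hv⟩, rfl⟩
    · cases i with
      | zero => exact hy₀
      | succ i => exact hy (i + 1)
    · convert hc k using 2 with i
      conv_rhs => rw [hy']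
      split_ifs <;> simp [ops_map_out]

theorem OmegaTRegExp.isOmegaRecognizable (E : OmegaTRegExp α) : IsOmegaRecognizable E.lang := by
  induction E with
  | plus E₁ E₂ h₁ h₂ => exact h₁.union h₂
  | concat R E h => exact h.prefix (isRegular_matches' R)
  | omega e => exact e.isSeqRecognizable.isOmegaRecognizable

end Recognizable

/-! ### Automata reading events -/

section Streams

variable {α : Type u} {K : Type}

theorem infChecks_iff_of_length_le_one {b : ℕ → List Bool} (hb : ∀ i, (b i).length ≤ 1) :
    InfChecks b ↔
      {n | ∀ k, ∃ i > k, b i = [false] ∧ finalValue 0 (block b 0 i) = n}.Infinite := by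
  classical
  have key : ∀ n m, (checked 0 (block b 0 m)).count n =
      Nat.count (fun i => b i = [false] ∧ finalValue 0 (block b 0 i) = n) m := by
    intro n m
    induction m with
    | zero => simp [block_self, checked]
    | succ m ih =>
      rw [block_succ (Nat.zero_le m), checked_append, List.count_append, ih, Nat.count_succ]
      congr 1
      have := hb m
      rcases h : b m with _ | ⟨c, _ | ⟨c', l⟩⟩
      · simp [checked]
      · cases c <;> simp [checked, List.count_singleton]
      · rw [h] at this; simp at this
  unfold InfChecks
  simp only [key, forall_exists_le_count_iff]

/-- Acceptance of a counter-check automaton only observes values. A passage from `n ≠ 0` to `0` must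
be a check, whereas `0` to `0` may occur without one; discarding the single value `0` keeps the set
infinite. -/
theorem infChecks_iff_finalValue {b : ℕ → List Bool} (hb : ∀ i, (b i).length ≤ 1) :
    InfChecks b ↔ {n | ∀ k, ∃ i > k, finalValue 0 (block b 0 i) = n ∧
      finalValue 0 (block b 0 (i + 1)) = 0}.Infinite := by
  rw [infChecks_iff_of_length_le_one hb]
  constructor
  · refine Set.Infinite.mono fun n hn k => ?_
    obtain ⟨i, hi, h1, h2⟩ := hn k
    exact ⟨i, hi, h2, by rw [block_succ (Nat.zero_le i), finalValue_append, h1]; rfl⟩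
  · intro h
    refine (h.sdiff (Set.finite_singleton 0)).mono fun n hn k => ?_
    obtain ⟨i, hi, h1, h2⟩ := hn.1 k
    have hn0 : n ≠ 0 := hn.2
    refine ⟨i, hi, ?_, h1⟩
    rw [block_succ (Nat.zero_le i), finalValue_append, h1] at h2
    have := hb i
    rcases hbi : b i with _ | ⟨c, _ | ⟨c', l⟩⟩
    · rw [hbi] at h2; exact absurd h2 hn0
    · cases c
      · rfl
      · rw [hbi] at h2; simp [finalValue] at h2
    · rw [hbi] at this; simp at this

theorem length_ops_singleton_le (k : K) (e : Event α K) : (ops k [e]).length ≤ 1 :=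
  List.length_filterMap_le _ _

theorem output_singleton (e : Event α K) : output [e] = (label e).toList := by
  cases e with
  | out o => simp [label]
  | op k b => simp [label]

theorem isConcat_toList_iff {w : ℕ → α} {o : ℕ → Option α} :
    IsConcat w (fun i => (o i).toList) ↔ ∃ f : ℕ → ℕ, StrictMono f ∧
      (∀ i, o (f i) = some (w i)) ∧ ∀ m, m ∉ Set.range f → o m = none := by
  classical
  constructor
  · rintro ⟨h1, h2⟩
    have hlen : ∀ m, (block (fun i => (o i).toList) 0 m).length =
        Nat.count (fun i => o i ≠ none) m := by
      intro m
      induction m with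
      | zero => simp [block_self]
      | succ m ih =>
        rw [block_succ (Nat.zero_le m), List.length_append, ih, Nat.count_succ]
        cases o m <;> simp
    have hinf : {i | o i ≠ none}.Infinite := by
      refine Set.infinite_of_forall_exists_gt fun k => ?_
      obtain ⟨i, hi, h⟩ := (forall_exists_le_count_iff (fun i => o i ≠ none)).1 (fun c => by
        obtain ⟨n, hn⟩ := h1 c
        exact ⟨n, by rw [← hlen]; exact hn.le⟩) k
      exact ⟨i, h, hi⟩
    refine ⟨Nat.nth fun i => o i ≠ none, Nat.nth_strictMono hinf, fun i => ?_, fun m hm => ?_⟩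
    · have hp : o (Nat.nth (fun i => o i ≠ none) i) ≠ none := Nat.nth_mem_of_infinite hinf i
      have hc : Nat.count (fun i => o i ≠ none) (Nat.nth (fun i => o i ≠ none) i) = i :=
        Nat.count_nth_of_infinite hinf i
      generalize Nat.nth (fun i => o i ≠ none) i = m at hp hc ⊢
      obtain ⟨a, ha⟩ := Option.ne_none_iff_exists'.1 hp
      have hl := hlen m
      rw [hc] at hl
      have hb := block_succ (u := fun i => (o i).toList) (Nat.zero_le m)
      rw [ha, h2 (m + 1) i (by rw [hb, ha]; simp [hl])]
      simp only [hb, ha]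
      rw [List.getElem_append_right hl.le]
      simp [hl]
    · by_contra h
      exact hm ⟨_, Nat.nth_count (p := fun i => o i ≠ none) h⟩
  · rintro ⟨f, hf, h1, h2⟩
    -- The blocks end just after the letter positions: block `i` runs from `g i` to `f i + 1 = g (i
    -- + 1)` and puts out only the letter `w i`.
    let g : ℕ → ℕ := fun i => Nat.casesOn i 0 fun i => f i + 1
    have hle : ∀ i, g i ≤ f i := by
      rintro (_ | i)
      · exact Nat.zero_le _
      · exact hf i.lt_succ_self
    have hg : IsCut g :=
      { zero := rfl
        mono := monotone_nat_of_le_succ fun i => (hle i).trans (Nat.le_succ _)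
        unbounded := fun m => ⟨m + 1, Nat.lt_succ_of_le hf.le_apply⟩ }
    rw [← hg.isConcat_iff]
    convert isConcat_singleton w using 2 with i
    change block _ (g i) (f i + 1) = _
    rw [block_succ (hle i), h1, block_congr (v := fun _ => [])]
    · simp [block]
    · intro m hm hmi
      rw [h2 m ?_]
      · rfl
      · rintro ⟨j, rfl⟩
        have hji : j < i := hf.lt_iff_lt.1 hmi
        obtain ⟨i, rfl⟩ : ∃ i', i = i' + 1 := ⟨i - 1, by omega⟩
        have : f j ≤ f i := hf.monotone (by omega)
        change f i + 1 ≤ f j at hm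
        omega

theorem IsConcat.infChecks_iff {e : ℕ → Event α K} {z : ℕ → List (Event α K)}
    (h : IsConcat e z) (k : K) :
    InfChecks (fun i => ops k (z i)) ↔ InfChecks fun i => ops k [e i] := by
  obtain ⟨f, hf, hz⟩ := h.exists_cut
  simp only [hz, ops_block, hf.infChecks_iff]

theorem IsConcat.isConcat_output_iff {e : ℕ → Event α K} {z : ℕ → List (Event α K)}
    (h : IsConcat e z) {w : ℕ → α} :
    IsConcat w (fun i => output (z i)) ↔ IsConcat w fun i => output [e i] := by
  obtain ⟨f, hf, hz⟩ := h.exists_cut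
  simp only [hz, output_block, hf.isConcat_iff]

end Streams

/-! ### Translation of event automata into counter-check automata, and concatenation of paths -/

section EventAutomaton

variable {α : Type u} {K Q : Type}

/-- The `ω`-words put out along infinite paths that start in `s` and check infinitely many values
of every counter infinitely often, in the automaton with transition relation `δ`. -/
def eventLang (δ : Q → Event α K → Q → Prop) (s : Q) : Set (ℕ → α) :=
  {w | ∃ (q : ℕ → Q) (e : ℕ → Event α K), q 0 = s ∧ (∀ i, δ (q i) (e i) (q (i + 1))) ∧
    (∀ k, InfChecks fun i => ops k [e i]) ∧ IsConcat w fun i => output [e i]}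

/-- The counter operation of an automaton with counters numbered by `φ` for an event. -/
def counterOp {N : ℕ} (hN : 0 < N) (φ : K ≃ Fin N) : Event α K → Fin N × CounterOp
  | out _ => (⟨0, hN⟩, .noOp)
  | op k true => (φ k, .inc)
  | op k false => (φ k, .check)

/-- The counter-check automaton with the transitions of an automaton reading events. -/
def ofEvents [Finite Q] {N : ℕ} (hN : 0 < N) (φ : K ≃ Fin N) (δ : Q → Event α K → Q → Prop)
    (s : Q) : CCA α where
  State := Q
  finite_state := inferInstance
  start := s
  N := N
  N_pos := hN
  Δ := {t | ∃ e, δ t.1 e t.2.2.1 ∧ label e = t.2.1 ∧ counterOp hN φ e = t.2.2.2}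
  noOp_first := by
    rintro s σ s' k ⟨e, -, -, h⟩
    rcases e with o | ⟨k', _ | _⟩
    · exact (congrArg Prod.fst h).symm
    · exact absurd (congrArg Prod.snd h) (by simp [counterOp])
    · exact absurd (congrArg Prod.snd h) (by simp [counterOp])

theorem counterOp_spec {N : ℕ} (hN : 0 < N) (φ : K ≃ Fin N) (e : Event α K) (v v' : Fin N → ℕ) :
    ((∀ h, h ≠ (counterOp hN φ e).1 → v' h = v h) ∧
      v' (counterOp hN φ e).1 = CCA.newValue (counterOp hN φ e).2 (v (counterOp hN φ e).1)) ↔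
    ∀ h, v' h = finalValue (v h) (ops (φ.symm h) [e]) := by
  rcases e with o | ⟨k, b⟩
  · simp only [counterOp, ops_out, ops_nil, finalValue, CCA.newValue]
    constructor
    · rintro ⟨h1, h2⟩ h
      by_cases hh : h = ⟨0, hN⟩
      · rw [hh]; exact h2
      · exact h1 h hh
    · exact fun h => ⟨fun k _ => h k, h _⟩
  · have hne : ∀ h, h ≠ φ k → ops (φ.symm h) [(op k b : Event α K)] = [] := fun h hh =>
      ops_op_of_ne (fun he => hh (by rw [he, Equiv.apply_symm_apply])) b []
    have h1 : (counterOp hN φ (op k b : Event α K)).1 = φ k := by cases b <;> rfl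
    have h2 : ∀ n, CCA.newValue (counterOp hN φ (op k b : Event α K)).2 n =
        finalValue n [b] := by cases b <;> exact fun _ => rfl
    rw [h1, h2]
    constructor
    · rintro ⟨h1, h2⟩ h
      by_cases hh : h = φ k
      · rw [hh, h2, Equiv.symm_apply_apply, ops_op_self, ops_nil]
      · rw [hne h hh, h1 h hh]; rfl
    · intro h
      refine ⟨fun h' hh => by rw [h h', hne h' hh]; rfl, ?_⟩
      rw [h, Equiv.symm_apply_apply, ops_op_self, ops_nil]

theorem ofEvents_step_iff [Finite Q] {N : ℕ} (hN : 0 < N) (φ : K ≃ Fin N)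
    (δ : Q → Event α K → Q → Prop) (s : Q) (σ : Option α) (c c' : (ofEvents hN φ δ s).Config) :
    (ofEvents hN φ δ s).Step σ c c' ↔ ∃ e, δ c.1 e c'.1 ∧ label e = σ ∧
      ∀ h, c'.2 h = finalValue (c.2 h) (ops (φ.symm h) [e]) := by
  constructor
  · rintro ⟨k, o, ⟨e, he, hl, hk⟩, h⟩
    refine ⟨e, he, hl, (counterOp_spec hN φ e _ _).1 ?_⟩
    rw [hk]
    exact h
  · rintro ⟨e, he, hl, h⟩
    exact ⟨_, _, ⟨e, he, hl, rfl⟩, (counterOp_spec hN φ e _ _).2 h⟩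

theorem lt_or_exists_between {f : ℕ → ℕ} (hf : StrictMono f) {m : ℕ} (hm : m ∉ Set.range f) :
    m < f 0 ∨ ∃ i, f i + 1 ≤ m ∧ m < f (i + 1) := by
  have hex : ∃ i, m < f i := ⟨m + 1, hf.le_apply.trans_lt (hf m.lt_succ_self)⟩
  obtain ⟨i, hi, hmin⟩ : ∃ i, m < f i ∧ ∀ j < i, ¬ m < f j :=
    ⟨_, Nat.find_spec hex, fun _ hj => Nat.find_min hex hj⟩
  cases i with
  | zero => exact Or.inl hi
  | succ i =>
    refine Or.inr ⟨i, ?_, hi⟩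
    have h1 := hmin i i.lt_succ_self
    have h2 : f i ≠ m := fun h => hm ⟨i, h⟩
    omega

/-- The counter vector at position `i` is determined by the operations before `i`, so a run amounts
to a path with events. -/
theorem eventLang_eq_lang [Finite Q] {N : ℕ} (hN : 0 < N) (φ : K ≃ Fin N)
    (δ : Q → Event α K → Q → Prop) (s : Q) :
    eventLang δ s = (ofEvents hN φ δ s).lang := by
  ext w
  constructor
  · rintro ⟨q, e, hq, hδ, hc, hw⟩
    simp only [output_singleton] at hw
    obtain ⟨f, hf, h1, h2⟩ := isConcat_toList_iff.1 hw
    let π : ℕ → (ofEvents hN φ δ s).Config := fun i =>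
      (q i, fun h => finalValue 0 (block (fun i => ops (φ.symm h) [e i]) 0 i))
    have hstep : ∀ i, (ofEvents hN φ δ s).Step (label (e i)) (π i) (π (i + 1)) := fun i =>
      (ofEvents_step_iff hN φ δ s _ _ _).2 ⟨e i, hδ i, rfl, fun h => by
        simp only [π]
        rw [block_succ (Nat.zero_le i), finalValue_append]⟩
    have hnone : ∀ m, m ∉ Set.range f → (ofEvents hN φ δ s).Step none (π m) (π (m + 1)) :=
      fun m hm => h2 m hm ▸ hstep m
    refine ⟨π, ⟨⟨?_, fun i => ⟨_, hstep i⟩⟩, f, hf, ⟨Nat.zero_le _, fun m _ hm => hnone m ?_⟩,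
      fun i => ⟨h1 i ▸ hstep (f i), hf i.lt_succ_self, fun m hm hm' => hnone m ?_⟩⟩, fun k => ?_⟩
    · simp only [π, hq, block_self]; rfl
    · rintro ⟨j, rfl⟩
      exact absurd (hf.lt_iff_lt.1 hm) (Nat.not_lt_zero j)
    · rintro ⟨j, rfl⟩
      have h3 : i < j := hf.lt_iff_lt.1 hm
      have h4 : j < i + 1 := hf.lt_iff_lt.1 hm'
      omega
    · exact (infChecks_iff_finalValue fun i => length_ops_singleton_le _ _).1 (hc (φ.symm k))
  · rintro ⟨π, ⟨⟨h0, -⟩, f, hf, ⟨-, he0⟩, hs⟩, hc⟩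
    -- A step may be witnessed by several transitions; the event is chosen with the label prescribed
    -- by the trace `f`.
    have hex : ∀ m, ∃ e, δ (π m).1 e (π (m + 1)).1 ∧
        (∀ h, (π (m + 1)).2 h = finalValue ((π m).2 h) (ops (φ.symm h) [e])) ∧
        (∀ i, f i = m → label e = some (w i)) ∧ (m ∉ Set.range f → label e = none) := by
      intro m
      by_cases hm : m ∈ Set.range f
      · obtain ⟨i, rfl⟩ := hm
        obtain ⟨e, he, hl, hv⟩ := (ofEvents_step_iff hN φ δ s _ _ _).1 (hs i).1
        exact ⟨e, he, hv, fun j hj => by rw [hf.injective hj]; exact hl,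
          fun h => absurd ⟨i, rfl⟩ h⟩
      · have hst : (ofEvents hN φ δ s).Step none (π m) (π (m + 1)) := by
          rcases lt_or_exists_between hf hm with h | ⟨i, hi, hi'⟩
          · exact he0 m (Nat.zero_le m) h
          · exact (hs i).2.2 m hi hi'
        obtain ⟨e, he, hl, hv⟩ := (ofEvents_step_iff hN φ δ s _ _ _).1 hst
        exact ⟨e, he, hv, fun j hj => absurd ⟨j, hj⟩ hm, fun _ => hl⟩
    choose e hδ hv hl hl' using hex
    have hval : ∀ h m, (π m).2 h = finalValue 0 (block (fun i => ops (φ.symm h) [e i]) 0 m) := by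
      intro h m
      induction m with
      | zero => rw [h0, block_self]; rfl
      | succ m ih => rw [hv, ih, block_succ (Nat.zero_le m), finalValue_append]
    refine ⟨fun m => (π m).1, e, by simp only [h0]; rfl, hδ, fun k => ?_, ?_⟩
    · rw [infChecks_iff_finalValue fun i => length_ops_singleton_le _ _]
      have hk : ∀ m, (π m).2 (φ k) = finalValue 0 (block (fun i => ops k [e i]) 0 m) := fun m => by
        have h := hval (φ k) m
        rw [Equiv.symm_apply_apply] at h
        exact h
      simp only [← hk]
      exact hc (φ k)
    · simp only [output_singleton]
      exact isConcat_toList_iff.2 ⟨f, hf, fun i => hl (f i) i rfl, hl'⟩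

theorem exists_lang_eq_eventLang [Finite Q] [Finite K] [Nonempty K]
    (δ : Q → Event α K → Q → Prop) (s : Q) : ∃ A : CCA α, eventLang δ s = A.lang :=
  ⟨_, eventLang_eq_lang Nat.card_pos (Finite.equivFin K) δ s⟩

/-- The list `T` of transitions is a path from `p` to `p'`. -/
def IsTrace (δ : Q → Event α K → Q → Prop) : Q → List (Q × Event α K × Q) → Q → Prop
  | p, [], p' => p = p'
  | p, t :: T, p' => t.1 = p ∧ δ t.1 t.2.1 t.2.2 ∧ IsTrace δ t.2.2 T p'

theorem IsTrace.append {δ : Q → Event α K → Q → Prop} {p p' p'' : Q}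
    {T T' : List (Q × Event α K × Q)} (h : IsTrace δ p T p') (h' : IsTrace δ p' T' p'') :
    IsTrace δ p (T ++ T') p'' := by
  induction T generalizing p with
  | nil => rw [show p = p' from h]; exact h'
  | cons t T ih => exact ⟨h.1, h.2.1, ih h.2.2⟩

theorem IsTrace.fst_getElem_zero {δ : Q → Event α K → Q → Prop} {p p' : Q}
    {T : List (Q × Event α K × Q)} (h : IsTrace δ p T p') (h0 : 0 < T.length) : T[0].1 = p := by
  cases T with
  | nil => simp at h0
  | cons t T => exact h.1

theorem IsTrace.getElem {δ : Q → Event α K → Q → Prop} {p p' : Q}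
    {T : List (Q × Event α K × Q)} (h : IsTrace δ p T p') (i : ℕ) (hi : i + 1 < T.length) :
    δ T[i].1 T[i].2.1 T[i + 1].1 := by
  induction T generalizing p i with
  | nil => simp at hi
  | cons t T ih =>
    cases i with
    | zero =>
      have := h.2.2.fst_getElem_zero (by simpa using hi)
      simpa [this] using h.2.1
    | succ i => simpa using ih h.2.2 i (by simpa using hi)

/-- There is a path from `p` to `p'` reading the word `x`. -/
def IsPath (δ : Q → Event α K → Q → Prop) (p : Q) (x : List (Event α K)) (p' : Q) : Prop :=
  ∃ T, IsTrace δ p T p' ∧ x = T.map fun t => t.2.1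

theorem IsPath.nil {δ : Q → Event α K → Q → Prop} (p : Q) : IsPath δ p [] p := ⟨[], rfl, rfl⟩

theorem IsPath.cons {δ : Q → Event α K → Q → Prop} {p p' p'' : Q} {e : Event α K}
    {x : List (Event α K)} (h : δ p e p') (h' : IsPath δ p' x p'') : IsPath δ p (e :: x) p'' := by
  obtain ⟨T, hT, rfl⟩ := h'
  exact ⟨(p, e, p') :: T, ⟨rfl, h, hT⟩, rfl⟩

/-- The traces are concatenated as words over the alphabet of transitions. Since each transition
records its source, states and events of the run are read off from one `ω`-word. -/
theorem exists_run_of_isPath {δ : Q → Event α K → Q → Prop} {t : ℕ → Q}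
    {z : ℕ → List (Event α K)} (h : ∀ i, IsPath δ (t i) (z i) (t (i + 1)))
    (hz : ∀ m, ∃ i ≥ m, z i ≠ []) :
    ∃ (q : ℕ → Q) (e : ℕ → Event α K), q 0 = t 0 ∧ (∀ i, δ (q i) (e i) (q (i + 1))) ∧
      IsConcat e z := by
  choose T hT hzT using h
  obtain rfl := funext hzT
  obtain ⟨τ, hτ⟩ := exists_isConcat (u := T) fun m => by
    obtain ⟨i, hi, hne⟩ := hz m
    exact ⟨i, hi, fun h => hne (by simp [h])⟩
  have hblock : ∀ n, IsTrace δ (t 0) (block T 0 n) (t n) := by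
    intro n
    induction n with
    | zero => rw [block_self]; exact rfl
    | succ n ih => rw [block_succ (Nat.zero_le n)]; exact ih.append (hT n)
  refine ⟨fun i => (τ i).1, fun i => (τ i).2.1, ?_, fun i => ?_, ?_, ?_⟩
  · obtain ⟨n, hn⟩ := hτ.1 0
    change (τ 0).1 = _
    rw [hτ.2 n 0 hn]
    exact (hblock n).fst_getElem_zero hn
  · obtain ⟨n, hn⟩ := hτ.1 (i + 1)
    change δ (τ i).1 (τ i).2.1 (τ (i + 1)).1
    rw [hτ.2 n (i + 1) hn, hτ.2 n i (by omega)]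
    exact (hblock n).getElem i hn
  all_goals
    have hmap : ∀ n, block (fun i => (T i).map fun t => t.2.1) 0 n =
        (block T 0 n).map fun t => t.2.1 := fun n =>
      (apply_block (φ := List.map fun t : Q × Event α K × Q => t.2.1) rfl
        (fun _ _ => List.map_append) T 0 n).symm
    simp only [hmap, List.length_map, List.getElem_map]
  · exact hτ.1
  · exact fun n i hi => by rw [hτ.2 n i hi]

end EventAutomaton

/-! ### Iterating regular languages of event words -/

section Iteration

variable {α : Type u} {J K τ : Type}

/-- The transitions of an automaton that reads a word of events along `step` from `I j` to a state
in `acc`, and then repeatedly such words from `R j` to a state in `acc`. After each of these words,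
a new counter is incremented a positive number of times and then checked. -/
inductive Iterate (step : τ → Event α K → τ) (acc : Set τ) (I R : J → τ) :
    Option (J × τ × Bool) → Event α (K ⊕ Unit) → Option (J × τ × Bool) → Prop
  | init (j : J) : Iterate step acc I R none (out none) (some (j, I j, false))
  | read (j : J) (q : τ) (e : Event α K) :
      Iterate step acc I R (some (j, q, false)) (e.map id .inl) (some (j, step q e, false))
  | enter (j : J) (q : τ) (h : q ∈ acc) :
      Iterate step acc I R (some (j, q, false)) (op (.inr ()) true) (some (j, q, true))
  | inc (j : J) (q : τ) :
      Iterate step acc I R (some (j, q, true)) (op (.inr ()) true) (some (j, q, true))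
  | check (j : J) (q : τ) :
      Iterate step acc I R (some (j, q, true)) (op (.inr ()) false) (some (j, R j, false))

/-- The word `x` followed by `c + 1` increments and a check of a new counter. -/
def delimited (x : List (Event α K)) (c : ℕ) : List (Event α (K ⊕ Unit)) :=
  x.map (map id .inl) ++ op (.inr ()) true ::
    (List.replicate c (op (.inr ()) true) ++ [op (.inr ()) false])

theorem ops_inl_delimited (k : K) (x : List (Event α K)) (c : ℕ) :
    ops (.inl k) (delimited x c) = ops k x := by
  have : ops (.inl k) (List.replicate c (op (.inr ()) true : Event α (K ⊕ Unit))) = [] := by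
    induction c with
    | zero => rfl
    | succ c ih => simp [List.replicate_succ, ih]
  simp [delimited, this]

theorem ops_inr_delimited (t : Unit) (x : List (Event α K)) (c : ℕ) :
    ops (.inr t) (delimited x c) = List.replicate (c + 1) true ++ [false] := by
  cases t
  have : ops (.inr ()) (List.replicate c (op (.inr ()) true : Event α (K ⊕ Unit))) =
      List.replicate c true := by
    induction c with
    | zero => rfl
    | succ c ih => simp [List.replicate_succ, ih]
  simp [delimited, this, List.replicate_succ]

theorem output_delimited (x : List (Event α K)) (c : ℕ) :
    output (delimited x c) = output x := by
  have : output (List.replicate c (op (.inr ()) true : Event α (K ⊕ Unit))) = [] := by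
    induction c with
    | zero => rfl
    | succ c ih => simp [List.replicate_succ, ih]
  simp [delimited, this]

variable {step : τ → Event α K → τ} {acc : Set τ} {I R : J → τ}

theorem Iterate.isPath_delimited (j : J) (p : τ) (x : List (Event α K)) (c : ℕ)
    (h : x.foldl step p ∈ acc) :
    IsPath (Iterate step acc I R) (some (j, p, false)) (delimited x c)
      (some (j, R j, false)) := by
  unfold delimited
  induction x generalizing p with
  | nil =>
    refine .cons (.enter j p h) ?_
    induction c with
    | zero => exact .cons (.check j p) (.nil _)
    | succ c ih => exact .cons (.inc j p) ih
  | cons e x ih => exact .cons (.read j p e) (ih (step p e) h)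

theorem block_singleton_cons {β : Type v} (e : ℕ → β) (a d : ℕ) :
    block (fun i => [e i]) a (a + (d + 1)) =
      e a :: block (fun i => [e i]) (a + 1) (a + 1 + d) := by
  simp [block_singleton, List.range'_succ]

theorem Iterate.exists_replicate {q : ℕ → Option (J × τ × Bool)} {e : ℕ → Event α (K ⊕ Unit)}
    (hδ : ∀ i, Iterate step acc I R (q i) (e i) (q (i + 1))) {j : J} {p : τ} (d a : ℕ)
    (ha : q a = some (j, p, true)) (hne : ∀ m, a ≤ m → m < a + d → e m ≠ op (.inr ()) false)
    (hd : e (a + d) = op (.inr ()) false) :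
    ∃ c, block (fun i => [e i]) a (a + (d + 1)) =
        List.replicate c (op (.inr ()) true) ++ [op (.inr ()) false] ∧
      q (a + (d + 1)) = some (j, R j, false) := by
  induction d generalizing a with
  | zero =>
    have h := hδ a
    rw [ha, show e a = _ from hd] at h
    refine ⟨0, ?_, ?_⟩
    · rw [block_singleton_cons, show e a = _ from hd]; simp [block_self]
    · generalize hq : q (a + 1) = t at h
      cases h
      rfl
  | succ d ih =>
    have h := hδ a
    rw [ha] at h
    have hea := hne a le_rfl (by omega)
    generalize hq : q (a + 1) = t at h
    generalize he : e a = ev at h hea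
    cases h with
    | inc =>
      obtain ⟨c, hc, hqc⟩ := ih (a + 1) hq (fun m hm hm' => hne m (by omega) (by omega))
        (by rw [← hd]; congr 1; omega)
      refine ⟨c + 1, ?_, ?_⟩
      · rw [block_singleton_cons, he, hc]; rfl
      · rw [← hqc]; congr 1; omega
    | check => exact absurd rfl hea

/-- The flag of a state records whether the delimiter has begun. Before that the new counter is not
touched, and afterwards only increments are possible up to the next check. -/
theorem Iterate.exists_delimited {q : ℕ → Option (J × τ × Bool)} {e : ℕ → Event α (K ⊕ Unit)}
    (hδ : ∀ i, Iterate step acc I R (q i) (e i) (q (i + 1))) {j : J} {p : τ} (d a : ℕ)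
    (ha : q a = some (j, p, false)) (hne : ∀ m, a ≤ m → m < a + d → e m ≠ op (.inr ()) false)
    (hd : e (a + d) = op (.inr ()) false) :
    ∃ x c, block (fun i => [e i]) a (a + (d + 1)) = delimited x c ∧ x.foldl step p ∈ acc ∧
      q (a + (d + 1)) = some (j, R j, false) := by
  induction d generalizing a p with
  | zero =>
    have h := hδ a
    rw [ha, show e a = _ from hd] at h
    generalize hq : q (a + 1) = t at h
    generalize he : (op (.inr ()) false : Event α (K ⊕ Unit)) = ev at h
    cases h with
    | read _ _ e' => cases e' <;> simp [map] at he
    | enter => simp at he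
  | succ d ih =>
    have h := hδ a
    rw [ha] at h
    generalize hq : q (a + 1) = t at h
    generalize he : e a = ev at h
    have hne' : ∀ m, a + 1 ≤ m → m < a + 1 + d → e m ≠ op (.inr ()) false :=
      fun m hm hm' => hne m (by omega) (by omega)
    have hd' : e (a + 1 + d) = op (.inr ()) false := by rw [← hd]; congr 1; omega
    have hidx : a + (d + 1 + 1) = a + 1 + (d + 1) := by omega
    cases h with
    | read _ _ e' =>
      obtain ⟨x, c, hx, hacc, hqc⟩ := ih (a + 1) hq hne' hd'
      refine ⟨e' :: x, c, ?_, hacc, by rw [hidx, hqc]⟩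
      rw [block_singleton_cons, he, hx]; rfl
    | enter _ _ hp =>
      obtain ⟨c, hc, hqc⟩ := Iterate.exists_replicate hδ d (a + 1) hq hne' hd'
      refine ⟨[], c, ?_, hp, by rw [hidx, hqc]⟩
      rw [block_singleton_cons, he, hc]; rfl

/-- The words that lead from `p` to a state in `acc` along `step`. -/
def foldLang (step : τ → Event α K → τ) (acc : Set τ) (p : τ) : Language (Event α K) :=
  {x : List (Event α K) | x.foldl step p ∈ acc}

/-- The new counter is checked infinitely often, and cutting the events after each of these checks
isolates delimited words. The numbers of increments are then forgotten. -/
theorem exists_seqLang_of_mem_eventLang {w : ℕ → α}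
    (hw : w ∈ eventLang (Iterate step acc I R) none) :
    ∃ j, ∃ u ∈ seqLang (headTail (foldLang step acc (I j)) (foldLang step acc (R j))),
      IsConcat w u := by
  classical
  obtain ⟨q, e, hq, hδ, hc, hw⟩ := hw
  let p : ℕ → Prop := fun m => e m = op (.inr ()) false
  have hinf : {m | p m}.Infinite := by
    refine Set.infinite_of_forall_exists_gt fun k => ?_
    obtain ⟨n, hn⟩ := ((infChecks_iff_of_length_le_one fun i =>
      length_ops_singleton_le _ _).1 (hc (.inr ()))).nonempty
    obtain ⟨i, hi, h, -⟩ := hn k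
    refine ⟨i, ?_, hi⟩
    change e i = _
    rcases he : e i with o | ⟨k | ⟨⟩, b⟩
    · simp [he] at h
    · simp [he] at h
    · simp [he] at h
      rw [h]
  have hmem : ∀ i, e (Nat.nth p i) = op (.inr ()) false := Nat.nth_mem_of_infinite hinf
  have hmono : StrictMono (Nat.nth p) := Nat.nth_strictMono hinf
  have hnot : ∀ m i, (∀ j < i, Nat.nth p j < m) → m < Nat.nth p i →
      e m ≠ op (.inr ()) false := by
    intro m i h1 h2 h
    have h3 : Nat.nth p (Nat.count p m) = m := Nat.nth_count (p := p) h
    rw [← h3] at h2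
    have h4 := h1 _ (hmono.lt_iff_lt.1 h2)
    omega
  obtain ⟨j, he0, hq1⟩ : ∃ j, e 0 = out none ∧ q 1 = some (j, I j, false) := by
    have h := hδ 0
    rw [hq] at h
    generalize hq1 : q (0 + 1) = t at h
    generalize he : e 0 = ev at h
    cases h with
    | init j => exact ⟨j, rfl, rfl⟩
  have hn0 : 1 ≤ Nat.nth p 0 := by
    rcases Nat.eq_zero_or_pos (Nat.nth p 0) with h | h
    · have := hmem 0
      rw [h, he0] at this
      simp at this
    · exact h
  -- Cut point `i + 1` lies just after the `i`-th check; the first block also contains the initial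
  -- silent event that selects `j`.
  let f : ℕ → ℕ := fun i => Nat.casesOn i 0 fun i => Nat.nth p i + 1
  have hfs : ∀ i, f (i + 1) = Nat.nth p i + 1 := fun _ => rfl
  have hf : IsCut f :=
    { zero := rfl
      mono := monotone_nat_of_le_succ fun i => by
        cases i with
        | zero => exact Nat.zero_le _
        | succ i => exact Nat.succ_le_succ (hmono i.lt_succ_self).le
      unbounded := fun m => ⟨m + 1, Nat.lt_succ_of_le hmono.le_apply⟩ }
  have hfirst : ∃ x c, block (fun i => [e i]) 0 (f 1) = out none :: delimited x c ∧
      x.foldl step (I j) ∈ acc ∧ q (f 1) = some (j, R j, false) := by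
    obtain ⟨d, hd⟩ := Nat.exists_eq_add_of_le hn0
    obtain ⟨x, c, h1, h2, h3⟩ := Iterate.exists_delimited hδ d 1 hq1
      (fun m _ hm => hnot m 0 (by simp) (by omega)) (hd ▸ hmem 0)
    have hf1 : f 1 = 1 + (d + 1) := (hfs 0).trans (by omega)
    refine ⟨x, c, ?_, h2, by rw [hf1, h3]⟩
    rw [hf1, ← h1, ← he0]
    have := block_singleton_cons e 0 (d + 1)
    rw [Nat.zero_add, Nat.zero_add] at this
    rw [← this]
    congr 1
    omega
  have hnext : ∀ i, q (f (i + 1)) = some (j, R j, false) →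
      ∃ x c, block (fun i => [e i]) (f (i + 1)) (f (i + 2)) = delimited x c ∧
        x.foldl step (R j) ∈ acc ∧ q (f (i + 2)) = some (j, R j, false) := by
    intro i hi
    obtain ⟨d, hd⟩ := Nat.exists_eq_add_of_le (show f (i + 1) ≤ Nat.nth p (i + 1) from
      hmono i.lt_succ_self)
    obtain ⟨x, c, h1, h2, h3⟩ := Iterate.exists_delimited hδ d _ hi
      (fun m hm hm' => hnot m (i + 1) (fun k hk => by
        have : Nat.nth p k ≤ Nat.nth p i := hmono.monotone (by omega)
        rw [hfs] at hm
        omega) (by omega)) (hd ▸ hmem (i + 1))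
    have hf2 : f (i + 2) = f (i + 1) + (d + 1) := by rw [hfs (i + 1), hd]; omega
    exact ⟨x, c, by rw [hf2, h1], h2, by rw [hf2, h3]⟩
  have hstate : ∀ i, q (f (i + 1)) = some (j, R j, false) := by
    intro i
    induction i with
    | zero => obtain ⟨-, -, -, -, h⟩ := hfirst; exact h
    | succ i ih => obtain ⟨-, -, -, -, h⟩ := hnext i ih; exact h
  have hall : ∀ i, ∃ x c, block (fun i => [e i]) (f i) (f (i + 1)) =
      (if i = 0 then [out none] else []) ++ delimited x c ∧
      x ∈ headTail (foldLang step acc (I j)) (foldLang step acc (R j)) i := by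
    rintro (_ | i)
    · obtain ⟨x, c, h1, h2, -⟩ := hfirst
      exact ⟨x, c, h1, h2⟩
    · obtain ⟨x, c, h1, h2, -⟩ := hnext i (hstate i)
      exact ⟨x, c, h1, h2⟩
  choose x c hx hmemx using hall
  have hcat : IsConcat e fun i => (if i = 0 then [out none] else []) ++ delimited (x i) (c i) := by
    simp only [← hx]
    exact hf.isConcat_iff.2 (isConcat_singleton e)
  refine ⟨j, _, ⟨x, hmemx, fun k => ?_, fun _ => rfl⟩, ?_⟩
  · convert (hcat.infChecks_iff (.inl k)).2 (hc (.inl k)) using 2 with i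
    split_ifs <;> simp [ops_inl_delimited]
  · convert hcat.isConcat_output_iff.2 hw using 2 with i
    split_ifs <;> simp [output_delimited]

theorem mem_eventLang_of_seqLang {w : ℕ → α} {j : J} {u : ℕ → List α}
    (hu : u ∈ seqLang (headTail (foldLang step acc (I j)) (foldLang step acc (R j))))
    (hw : IsConcat w u) : w ∈ eventLang (Iterate step acc I R) none := by
  obtain ⟨x, hx, hc, hux⟩ := hu
  obtain rfl := funext hux
  let t : ℕ → Option (J × τ × Bool) := fun i => if i = 0 then none else some (j, R j, false)
  -- The increment counts are chosen so that the new counter checks every positive value infinitely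
  -- often.
  let z : ℕ → List (Event α (K ⊕ Unit)) := fun i =>
    (if i = 0 then [out none] else []) ++ delimited (x i) (Nat.unpair i).1
  have hz : ∀ i, IsPath (Iterate step acc I R) (t i) (z i) (t (i + 1)) := by
    rintro (_ | i)
    · exact .cons (.init j) (Iterate.isPath_delimited j _ _ _ (hx 0))
    · exact Iterate.isPath_delimited j _ _ _ (hx (i + 1))
  obtain ⟨q, e, hq, hδ, hcat⟩ := exists_run_of_isPath hz fun m =>
    ⟨m, le_rfl, by simp [z, delimited]⟩
  refine ⟨q, e, hq, hδ, fun k => (hcat.infChecks_iff k).1 ?_, hcat.isConcat_output_iff.1 ?_⟩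
  · rcases k with k | k
    · convert hc k using 2 with i
      simp only [z]
      split_ifs <;> simp [ops_inl_delimited]
    · have : (fun i => ops (.inr k) (z i)) =
          fun i => List.replicate ((Nat.unpair i).1 + 1) true ++ [false] := by
        funext i
        simp only [z]
        split_ifs <;> simp [ops_inr_delimited]
      rw [this]
      exact (infChecks_replicate_iff _).2 (infinite_setOf_unpair_fst 1)
  · convert hw using 2 with i
    simp only [z]
    split_ifs <;> simp [output_delimited]

theorem IsOmegaRecognizable.exists_cca {W : Set (ℕ → α)} (h : IsOmegaRecognizable W) :
    ∃ A : CCA α, W = A.lang := by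
  obtain ⟨J, K, _, _, Y, X, hY, hX, hW⟩ := h
  choose σ fσ M hM using hY
  choose σ' fσ' M' hM' using hX
  -- All automata for first and later words are run in one disjoint sum, whose components are
  -- invariant under `step`.
  let step : (Σ j, σ j) ⊕ (Σ j, σ' j) → Event α K → (Σ j, σ j) ⊕ (Σ j, σ' j)
    | .inl q, e => .inl ⟨q.1, (M q.1).step q.2 e⟩
    | .inr q, e => .inr ⟨q.1, (M' q.1).step q.2 e⟩
  let acc : Set ((Σ j, σ j) ⊕ (Σ j, σ' j)) :=
    {q | Sum.elim (fun q => q.2 ∈ (M q.1).accept) (fun q => q.2 ∈ (M' q.1).accept) q}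
  have h1 : ∀ j (q : σ j) (x : List (Event α K)), x.foldl step (.inl ⟨j, q⟩) = .inl ⟨j, (M j).evalFrom q x⟩ := by
    intro j q x
    induction x generalizing q with
    | nil => rfl
    | cons e x ih => exact ih _
  have h2 : ∀ j (q : σ' j) (x : List (Event α K)), x.foldl step (.inr ⟨j, q⟩) = .inr ⟨j, (M' j).evalFrom q x⟩ := by
    intro j q x
    induction x generalizing q with
    | nil => rfl
    | cons e x ih => exact ih _
  have e1 : ∀ j, foldLang step acc (.inl ⟨j, (M j).start⟩) = Y j := by
    intro j
    rw [← hM j]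
    ext x
    change x.foldl step _ ∈ acc ↔ _
    rw [h1]
    exact Iff.rfl
  have e2 : ∀ j, foldLang step acc (.inr ⟨j, (M' j).start⟩) = X j := by
    intro j
    rw [← hM' j]
    ext x
    change x.foldl step _ ∈ acc ↔ _
    rw [h2]
    exact Iff.rfl
  obtain ⟨A, hA⟩ := exists_lang_eq_eventLang
    (Iterate step acc (fun j => .inl ⟨j, (M j).start⟩) fun j => .inr ⟨j, (M' j).start⟩) none
  refine ⟨A, ?_⟩
  rw [← hA]
  ext w
  rw [hW]
  simp only [← e1, ← e2]
  exact ⟨fun ⟨j, u, hu, hw⟩ => mem_eventLang_of_seqLang hu hw, exists_seqLang_of_mem_eventLang⟩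

end Iteration

end OmegaT

theorem mainTheorem2 {α : Type*} [Finite α] [Nonempty α] (E : OmegaT.OmegaTRegExp α) :
    ∃ A : OmegaT.CCA α, E.lang = A.lang :=
  E.isOmegaRecognizable.exists_cca
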